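/- Topological groups are assumed Hausdorff. For a locally compact group $G$, a continuous function $u:G\to\mathbb C$ is a \emph{Herz--Schur multiplier}, $u\in B_2(G)$, if for every bounded operator $A=[a_{xy}]_{x,y\in G}$ on $\ell^2(G)$ the matrix $[u(y^{-1}x)a_{xy}]_{x,y\in G}$ represents a bounded operator $m(A)$ on $\ell^2(G)$; its norm $\|u\|_{B_2}$ is the operator norm of $A\mapsto m(A)$ on $B(\ell^2(G))$. The group $G$ has the \emph{weak Haagerup property} if for some constant $C>0$ there is a net $(u_\alpha)$ in $B_2(G)\cap C_0(G)$ with $\|u_\alpha\|_{B_2}\le C$ for all $\alpha$ and $u_\alpha\to 1$ uniformly on compact sets; $\Lambda_{\mathrm{WH}}(G)\in[0,\infty]$ is the infimum of all such $C$ (and $\infty$ if there are none). A locally compact group is \emph{amenable} if its bounded continuous functions admit a left-invariant mean. A \emph{lattice} in $G$ is a discrete subgroup $\Gamma$ such that $G/\Gamma$ admits a nonzero finite $G$-invariant Borel measure. Theorem. Let $G$ be a locally compact group. (1) If $H$ is a closed subgroup of $G$ and $G$ has the weak Haagerup property, then so does $H$; more precisely, $\Lambda_{\mathrm{WH}}(H)\le\Lambda_{\mathrm{WH}}(G)$.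 (2) If $K$ is a compact normal subgroup of $G$, then $G$ has the weak Haagerup property if and only if $G/K$ does; more precisely, $\Lambda_{\mathrm{WH}}(G)=\Lambda_{\mathrm{WH}}(G/K)$. (3) The weak Haagerup property is preserved under finite direct products; more precisely, if $G'$ is a locally compact group, then $\Lambda_{\mathrm{WH}}(G\times G')\le\Lambda_{\mathrm{WH}}(G)\,\Lambda_{\mathrm{WH}}(G')$. (4) If $(G_i)_{i\in I}$ is a (nonempty, upward) directed family of open subgroups of $G$, then $\Lambda_{\mathrm{WH}}\bigl(\bigcup_i G_i\bigr)=\lim_i\Lambda_{\mathrm{WH}}(G_i)$ in $[0,\infty]$. (5) If $N$ is a closed normal subgroup of $G$, where $G$ is second countable or discrete, and $G/N$ is amenable, then $G$ has the weak Haagerup property if and only if $N$ does; more precisely, $\Lambda_{\mathrm{WH}}(G)=\Lambda_{\mathrm{WH}}(N)$. (6) If $\Gamma$ is a lattice in $G$ and $G$ is second countable, then $G$ has the weak Haagerup property if and only if $\Gamma$ does; more precisely, $\Lambda_{\mathrm{WH}}(\Gamma)=\Lambda_{\mathrm{WH}}(G)$. -/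

import Mathlib

open Filter Topology MeasureTheory
open scoped ENNReal NNReal ZeroAtInfty BoundedContinuousFunction

universe u v w

noncomputable section

namespace WeakHaagerup

/-- The Hilbert space `ℓ²(X)` of square-summable complex functions on a set `X`. -/
abbrev ellTwo (X : Type u) : Type u := lp (fun _ : X => ℂ) 2

open Classical in
/-- The matrix entry `a_{xy}` of a bounded operator `A` on `ℓ²(X)`, that is, the `x`-th coordinate
of the image under `A` of the `y`-th standard basis vector. -/
def entry {X : Type u} (A : ellTwo X →L[ℂ] ellTwo X) (x y : X) : ℂ :=
  (A (lp.single 2 y (1 : ℂ)) : X → ℂ) x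

/-- The bounded operator `B` is represented by the matrix `[k(x,y) a_{xy}]`, where `[a_{xy}]` is
the matrix of `A`. Such a `B` is unique if it exists, and is denoted `m_k(A)`. -/
def IsSchurProduct {X : Type u} (k : X → X → ℂ) (A B : ellTwo X →L[ℂ] ellTwo X) : Prop :=
  ∀ x y : X, entry B x y = k x y * entry A x y

/-- `k` is a Schur multiplier on `X`: for every bounded operator `A` on `ℓ²(X)` the matrix
`[k(x,y) a_{xy}]` represents a bounded operator. -/
def IsSchurMultiplier {X : Type u} (k : X → X → ℂ) : Prop :=
  ∀ A : ellTwo X →L[ℂ] ellTwo X, ∃ B : ellTwo X →L[ℂ] ellTwo X, IsSchurProduct k A B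

/-- The Schur norm `‖k‖_S`, that is, the operator norm of `m_k` on `B(ℓ²(X))`: the infimum of the
constants `c ≥ 0` such that `‖m_k(A)‖ ≤ c ‖A‖` for all `A` (and `∞` if there is none). -/
def schurNorm {X : Type u} (k : X → X → ℂ) : ℝ≥0∞ :=
  ⨅ (c : ℝ≥0) (_ : ∀ A : ellTwo X →L[ℂ] ellTwo X, ∃ B : ellTwo X →L[ℂ] ellTwo X,
    IsSchurProduct k A B ∧ ‖B‖ ≤ c * ‖A‖), (c : ℝ≥0∞)

/-- The kernel `(x, y) ↦ u(y⁻¹ x)`. -/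
def hatKernel {G : Type u} [Group G] (f : G → ℂ) (x y : G) : ℂ := f (y⁻¹ * x)

/-- `f ∈ B₂(G)`: `f` is continuous and its kernel is a Schur multiplier on `G`. -/
def IsHerzSchurMultiplier {G : Type u} [Group G] [TopologicalSpace G] (f : G → ℂ) : Prop :=
  Continuous f ∧ IsSchurMultiplier (hatKernel f)

/-- The Herz-Schur norm `‖f‖_{B₂}`. -/
def herzSchurNorm {G : Type u} [Group G] (f : G → ℂ) : ℝ≥0∞ := schurNorm (hatKernel f)

/-- There is a net in `B₂(G) ∩ C₀(G)` with Herz-Schur norms at most `C` that converges to `1`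
uniformly on compact sets. -/
def HasNetWithBound (G : Type u) [Group G] [TopologicalSpace G] (C : ℝ≥0) : Prop :=
  ∃ (ι : Type u) (_ : Preorder ι) (_ : IsDirected ι (· ≤ ·)) (_ : Nonempty ι)
    (f : ι → C₀(G, ℂ)),
    (∀ i, IsHerzSchurMultiplier (f i : G → ℂ)) ∧
    (∀ i, herzSchurNorm (f i : G → ℂ) ≤ C) ∧
    ∀ L : Set G, IsCompact L →
      TendstoUniformlyOn (fun i => (f i : G → ℂ)) (fun _ => 1) atTop L

/-- The weak Haagerup property. -/
def HasWeakHaagerup (G : Type u) [Group G] [TopologicalSpace G] : Prop :=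
  ∃ C : ℝ≥0, 0 < C ∧ HasNetWithBound G C

/-- The weak Haagerup constant `Λ_WH(G)`, with value `∞` if `G` does not have the weak Haagerup
property. -/
def weakHaagerupConst (G : Type u) [Group G] [TopologicalSpace G] : ℝ≥0∞ :=
  ⨅ (C : ℝ≥0) (_ : 0 < C ∧ HasNetWithBound G C), (C : ℝ≥0∞)

/-- Amenability: there is a left-invariant mean on the bounded continuous functions. -/
def IsAmenable (G : Type u) [Group G] [TopologicalSpace G] [ContinuousMul G] : Prop :=
  ∃ m : (G →ᵇ ℝ) →ₗ[ℝ] ℝ,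
    (∀ f : G →ᵇ ℝ, (∀ x, 0 ≤ f x) → 0 ≤ m f) ∧
    m (BoundedContinuousFunction.const G 1) = 1 ∧
    ∀ (g : G) (f : G →ᵇ ℝ), m (f.compContinuous ⟨fun x => g * x, continuous_const_mul g⟩) = m f

/-- A lattice: a discrete subgroup `Γ` such that `G ⧸ Γ` carries a nonzero finite Borel measure
that is invariant under the left translation action of `G`. -/
def IsLattice {G : Type u} [Group G] [TopologicalSpace G] (Γ : Subgroup G) : Prop :=
  DiscreteTopology Γ ∧
    ∃ μ : @Measure (G ⧸ Γ) (borel (G ⧸ Γ)), μ ≠ 0 ∧ μ Set.univ < ∞ ∧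
      ∀ (g : G) (s : Set (G ⧸ Γ)), MeasurableSet[borel (G ⧸ Γ)] s →
        μ ((fun x => g • x) ⁻¹' s) = μ s

end WeakHaagerup

end

open scoped Pointwise

set_option linter.unusedSectionVars false
set_option linter.overlappingInstances false

namespace WeakHaagerup

/-! The Herz–Schur norm is traded for the inequality `SchurBdd`, which tests finite sums only and
makes sense for rectangular kernels on any two index sets. In this form multipliers survive
relabelling of rows and columns by arbitrary maps, products, restriction to diagonal blocks and
averaging. The symmetrised right-hand side is additive in the two vectors, so blocks and integrals
can be summed term by term. The net becomes `NetBound`: one good function for each compact set and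
each ε.

The soft statements each need one construction. Functions are restricted to closed subgroups, pulled
back along quotients by compact `K` or averaged over `K` with Haar probability, multiplied as
`f(x)g(y)` on products, and extended by zero from open subgroups. A compact subset of a directed
union of open subgroups already lies in one of them.

Amenable quotients and lattices share an induction procedure from a closed subgroup `H`. Suppose `h
≥ 0` in `C_c(G/H)` has L² norm at most 1 for an invariant measure and `∫ h(z)h(gz)` is close to 1
for `g` in a compact set. Lift `h` to `W` in `C_c(G)` whose integrals over the cosets are `h`, and
average `f(l⁻¹k)` with weight `W(pk)W(gpl)` (`transfer`). Compact support of `W` preserves decay at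
infinity, the constant 1 induces `∫ h(z)h(gz)`, and the Schur bound does not grow because the
weights split into a row part and a column part of L² norm at most 1 (`schurBdd_transfer`).

For a lattice, `h` is a cutoff equal to 1 on a compact set of nearly full measure. For an amenable
quotient, `h` is the square root of an almost invariant L¹ density, obtained from the mean by
Hahn–Banach (`exists_almost_invariant_L1`). The discrete case reduces to countable, finitely
generated subgroups. -/

/-- The matrix `a` defines a bounded sesquilinear form of norm at most `c` on finitely supported
vectors, stated in the equivalent symmetrised form. -/
def MatBdd {X : Type*} {Y : Type*} (a : X → Y → ℂ) (c : ℝ) : Prop :=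
  ∀ (F : Finset X) (E : Finset Y) (η : X → ℂ) (ξ : Y → ℂ),
    ‖∑ x ∈ F, ∑ y ∈ E, a x y * (η x * ξ y)‖ ≤ c * ((∑ x ∈ F, ‖η x‖ ^ 2 + ∑ y ∈ E, ‖ξ y‖ ^ 2) / 2)

/-- Schur multiplication by `k` multiplies the norm of a matrix by at most `C`. -/
def SchurBdd {X : Type*} {Y : Type*} (k : X → Y → ℂ) (C : ℝ) : Prop :=
  ∀ (a : X → Y → ℂ) (c : ℝ), 0 ≤ c → MatBdd a c → MatBdd (fun x y => k x y * a x y) (C * c)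

/-! ### Bounded operators on `ℓ²` and bounded matrices -/

section Operators

variable {X : Type u}

open Classical in
theorem ellTwo_coord_sum_single (A : ellTwo X →L[ℂ] ellTwo X) (E : Finset X) (ξ : X → ℂ) (x : X) :
    (A (∑ y ∈ E, lp.single 2 y (ξ y)) : X → ℂ) x = ∑ y ∈ E, entry A x y * ξ y := by
  rw [map_sum, lp.coeFn_sum, Finset.sum_apply]
  refine Finset.sum_congr rfl fun y _ => ?_
  have : (lp.single 2 y (ξ y) : ellTwo X) = ξ y • lp.single 2 y (1 : ℂ) := by
    rw [← lp.single_smul]; simp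
  rw [this, map_smul, lp.coeFn_smul, Pi.smul_apply, entry, smul_eq_mul, mul_comm]

theorem ellTwo_sum_sq_le (v : ellTwo X) (F : Finset X) : ∑ x ∈ F, ‖(v : X → ℂ) x‖ ^ 2 ≤ ‖v‖ ^ 2 := by
  have := lp.sum_rpow_le_norm_rpow (p := 2) (by simp) v F
  simpa using this

open Classical in
theorem matBdd_entry (A : ellTwo X →L[ℂ] ellTwo X) : MatBdd (entry A) ‖A‖ := by
  intro F E η ξ
  set v : ellTwo X := ∑ y ∈ E, lp.single 2 y (ξ y) with hv
  have hvn : ‖v‖ ^ 2 = ∑ y ∈ E, ‖ξ y‖ ^ 2 := by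
    have := lp.norm_sum_single (E := fun _ : X => ℂ) (p := 2) (by simp) ξ E
    simpa using this
  have h1 : ∑ x ∈ F, ∑ y ∈ E, entry A x y * (η x * ξ y) = ∑ x ∈ F, η x * (A v : X → ℂ) x := by
    refine Finset.sum_congr rfl fun x _ => ?_
    rw [hv, ellTwo_coord_sum_single, Finset.mul_sum]
    exact Finset.sum_congr rfl fun y _ => by ring
  rw [h1]
  have h2 : ‖∑ x ∈ F, η x * (A v : X → ℂ) x‖ ≤ ∑ x ∈ F, ‖η x‖ * ‖(A v : X → ℂ) x‖ :=
    (norm_sum_le _ _).trans (le_of_eq (Finset.sum_congr rfl fun x _ => norm_mul _ _))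
  have h3 : (∑ x ∈ F, ‖η x‖ * ‖(A v : X → ℂ) x‖) ^ 2 ≤
      (∑ x ∈ F, ‖η x‖ ^ 2) * (‖A‖ * ‖v‖) ^ 2 := by
    refine (Finset.sum_mul_sq_le_sq_mul_sq _ _ _).trans ?_
    refine mul_le_mul_of_nonneg_left ?_ (by positivity)
    refine (ellTwo_sum_sq_le _ _).trans ?_
    gcongr
    exact A.le_opNorm v
  rw [← hvn]
  set S := ∑ x ∈ F, ‖η x‖ ^ 2
  have hS : 0 ≤ S := by positivity
  refine h2.trans (abs_le_of_sq_le_sq' (h3.trans ?_) (by positivity)).2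
  have : S * ‖v‖ ^ 2 ≤ ((S + ‖v‖ ^ 2) / 2) ^ 2 := by nlinarith [sq_nonneg (S - ‖v‖ ^ 2)]
  calc S * (‖A‖ * ‖v‖) ^ 2 = ‖A‖ ^ 2 * (S * ‖v‖ ^ 2) := by ring
    _ ≤ ‖A‖ ^ 2 * ((S + ‖v‖ ^ 2) / 2) ^ 2 := by gcongr
    _ = _ := by ring

/-- Testing the form against `t` times the conjugate of `aξ` gives `tS ≤ c(t²S + B)/2`, and `t =
c⁻¹` is the optimal scaling. This recovers the operator bound from the symmetrised one. -/
theorem MatBdd.sum_sq_le {Y : Type*} {Z : Type*} {a : Z → Y → ℂ} {c : ℝ} (ha : MatBdd a c)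
    (hc : 0 ≤ c) (F : Finset Z) (E : Finset Y) (ξ : Y → ℂ) :
    ∑ x ∈ F, ‖∑ y ∈ E, a x y * ξ y‖ ^ 2 ≤ c ^ 2 * ∑ y ∈ E, ‖ξ y‖ ^ 2 := by
  set S := ∑ x ∈ F, ‖∑ y ∈ E, a x y * ξ y‖ ^ 2 with hSdef
  set B := ∑ y ∈ E, ‖ξ y‖ ^ 2
  have hS : 0 ≤ S := by positivity
  have hB : 0 ≤ B := by positivity
  have key : ∀ t : ℝ, 0 < t → t * S ≤ c * ((t ^ 2 * S + B) / 2) := by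
    intro t ht
    have h := ha F E (fun x => (t : ℂ) * (starRingEnd ℂ) (∑ y ∈ E, a x y * ξ y)) ξ
    have h1 : ∑ x ∈ F, ∑ y ∈ E, a x y *
        ((t : ℂ) * (starRingEnd ℂ) (∑ y ∈ E, a x y * ξ y) * ξ y) = ((t * S : ℝ) : ℂ) := by
      rw [hSdef, Finset.mul_sum, Complex.ofReal_sum]
      refine Finset.sum_congr rfl fun x _ => ?_
      rw [Complex.ofReal_mul, Complex.ofReal_pow, ← Complex.mul_conj', mul_comm (∑ y ∈ E, _),
        ← mul_assoc, Finset.mul_sum]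
      refine Finset.sum_congr rfl fun y _ => by ring
    rw [h1, Complex.norm_real, Real.norm_of_nonneg (by positivity)] at h
    refine h.trans (le_of_eq ?_)
    congr 3
    rw [hSdef, Finset.mul_sum]
    refine Finset.sum_congr rfl fun x _ => ?_
    rw [norm_mul, RCLike.norm_conj, mul_pow, Complex.norm_real, Real.norm_of_nonneg ht.le]
  rcases hc.eq_or_lt with rfl | hc
  · have := key 1 one_pos
    simp at this ⊢
    linarith
  · have h := key c⁻¹ (inv_pos.2 hc)
    have h2 : c⁻¹ * S * c = S := by field_simp
    have h3 : c * ((c⁻¹ ^ 2 * S + B) / 2) * c = S / 2 + c ^ 2 * B / 2 := by field_simp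
    have := mul_le_mul_of_nonneg_right h hc.le
    rw [h2, h3] at this
    linarith

open Classical in
theorem MatBdd.exists_operator {a : X → X → ℂ} {c : ℝ} (ha : MatBdd a c) (hc : 0 ≤ c) :
    ∃ B : ellTwo X →L[ℂ] ellTwo X, (∀ x y, entry B x y = a x y) ∧ ‖B‖ ≤ c := by
  -- Applying the matrix to its own conjugated row gives `S² ≤ c²S`, so every row lies in `ℓ²` and
  -- the operator can be defined by inner products with the rows.
  have hrow : ∀ x, Memℓp (fun y => (starRingEnd ℂ) (a x y)) 2 := by
    intro x
    refine memℓp_gen' (C := c ^ 2) fun E => ?_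
    have key : ∑ y ∈ E, ‖a x y‖ ^ 2 ≤ c ^ 2 := by
      set S := ∑ y ∈ E, ‖a x y‖ ^ 2 with hS
      have h := ha.sum_sq_le hc {x} E (fun y => (starRingEnd ℂ) (a x y))
      have h1 : ∑ y ∈ E, a x y * (starRingEnd ℂ) (a x y) = ((S : ℝ) : ℂ) := by
        rw [hS, Complex.ofReal_sum]
        exact Finset.sum_congr rfl fun y _ => by rw [Complex.mul_conj', Complex.ofReal_pow]
      rw [Finset.sum_singleton, h1, Complex.norm_real, Real.norm_of_nonneg (by positivity)] at h
      simp only [RCLike.norm_conj] at h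
      rw [← hS] at h
      by_contra hcon
      push Not at hcon
      have : 0 < S := lt_of_le_of_lt (by positivity) hcon
      nlinarith
    simpa using key
  let r : X → ellTwo X := fun x => ⟨fun y => (starRingEnd ℂ) (a x y), hrow x⟩
  have hsum : ∀ (v : ellTwo X) (x : X),
      HasSum (fun y => a x y * (v : X → ℂ) y) (inner ℂ (r x) v) := by
    intro v x
    have := lp.hasSum_inner (𝕜 := ℂ) (r x) v
    refine this.congr_fun ?_ |> fun h => h
    intro y
    simp [r, mul_comm]
  have hbd : ∀ (v : ellTwo X) (F : Finset X), ∑ x ∈ F, ‖inner ℂ (r x) v‖ ^ 2 ≤ (c * ‖v‖) ^ 2 := by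
    intro v F
    have ht : Tendsto (fun E : Finset X => ∑ x ∈ F, ‖∑ y ∈ E, a x y * (v : X → ℂ) y‖ ^ 2) atTop
        (𝓝 (∑ x ∈ F, ‖inner ℂ (r x) v‖ ^ 2)) :=
      tendsto_finsetSum _ fun x _ => ((hsum v x).norm.pow 2)
    refine le_of_tendsto' ht fun E => (ha.sum_sq_le hc F E _).trans ?_
    rw [mul_pow]
    gcongr
    exact ellTwo_sum_sq_le v E
  have hmem : ∀ v : ellTwo X, Memℓp (fun x => inner ℂ (r x) v) 2 := fun v =>
    memℓp_gen' (C := (c * ‖v‖) ^ 2) fun F => by simpa using hbd v F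
  let B₀ : ellTwo X →ₗ[ℂ] ellTwo X :=
    { toFun := fun v => ⟨fun x => inner ℂ (r x) v, hmem v⟩
      map_add' := fun v w => by ext x; exact inner_add_right _ _ _
      map_smul' := fun t v => by ext x; exact inner_smul_right _ _ _ }
  have hB₀ : ∀ v, ‖B₀ v‖ ≤ c * ‖v‖ := fun v =>
    lp.norm_le_of_forall_sum_le (p := 2) (by simp) (by positivity) fun F => by
      simpa [B₀] using hbd v F
  refine ⟨B₀.mkContinuous c hB₀, fun x y => ?_, B₀.mkContinuous_norm_le hc _⟩
  change inner ℂ (r x) (lp.single 2 y (1 : ℂ) : ellTwo X) = a x y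
  have h1 := hsum (lp.single 2 y (1 : ℂ)) x
  have h2 : HasSum (fun z => a x z * (lp.single 2 y (1 : ℂ) : ellTwo X) z) (a x y) := by
    have := hasSum_single (f := fun z => a x z * (lp.single 2 y (1 : ℂ) : ellTwo X) z) y
      (fun z hz => by simp [lp.single_apply, hz])
    simpa using this
  exact h1.unique h2

theorem MatBdd.mono {Y : Type*} {Z : Type*} {a : Z → Y → ℂ} {c d : ℝ} (ha : MatBdd a c)
    (h : c ≤ d) : MatBdd a d := fun F E η ξ =>
  (ha F E η ξ).trans (mul_le_mul_of_nonneg_right h (by positivity))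

theorem SchurBdd.mono {Y : Type*} {Z : Type*} {k : Z → Y → ℂ} {C D : ℝ} (hk : SchurBdd k C)
    (h : C ≤ D) : SchurBdd k D := fun a c hc ha =>
  (hk a c hc ha).mono (mul_le_mul_of_nonneg_right h hc)

theorem SchurBdd.exists_schurProduct {k : X → X → ℂ} {C : ℝ≥0} (hk : SchurBdd k C)
    (A : ellTwo X →L[ℂ] ellTwo X) : ∃ B, IsSchurProduct k A B ∧ ‖B‖ ≤ C * ‖A‖ := by
  obtain ⟨B, h1, h2⟩ := (hk _ _ (norm_nonneg _) (matBdd_entry A)).exists_operator (by positivity)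
  exact ⟨B, h1, h2⟩

theorem schurNorm_le_iff {k : X → X → ℂ} {C : ℝ≥0} : schurNorm k ≤ C ↔ SchurBdd k C := by
  constructor
  · intro h a c hc ha F E η ξ
    obtain ⟨A, hA, hAn⟩ := ha.exists_operator hc
    -- The norm is an infimum, so only constants above `C` are known to be admissible; the bound at
    -- `C` follows by letting `D` decrease to `C` in the finite inequality.
    have key : ∀ D : ℝ, (C : ℝ) < D → ‖∑ x ∈ F, ∑ y ∈ E, k x y * a x y * (η x * ξ y)‖ ≤
        D * c * ((∑ x ∈ F, ‖η x‖ ^ 2 + ∑ y ∈ E, ‖ξ y‖ ^ 2) / 2) := by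
      intro D hD
      have hD0 : 0 ≤ D := C.2.trans hD.le
      lift D to ℝ≥0 using hD0
      have hlt : schurNorm k < (D : ℝ≥0∞) := h.trans_lt (by exact_mod_cast hD)
      rw [schurNorm, iInf_lt_iff] at hlt
      obtain ⟨d, hd⟩ := hlt
      rw [iInf_lt_iff] at hd
      obtain ⟨hd, hdD⟩ := hd
      obtain ⟨B, hB, hBn⟩ := hd A
      have hdD' : (d : ℝ) ≤ D := by exact_mod_cast hdD.le
      have h1 := ((matBdd_entry B).mono (hBn.trans (mul_le_mul hdD' hAn (norm_nonneg _) D.2))) F E η ξ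
      simpa only [hB _ _, hA] using h1
    have ht : Tendsto (fun D : ℝ => D * c * ((∑ x ∈ F, ‖η x‖ ^ 2 + ∑ y ∈ E, ‖ξ y‖ ^ 2) / 2))
        (𝓝[>] (C : ℝ)) (𝓝 (C * c * ((∑ x ∈ F, ‖η x‖ ^ 2 + ∑ y ∈ E, ‖ξ y‖ ^ 2) / 2))) :=
      (Continuous.tendsto (by fun_prop) _).mono_left nhdsWithin_le_nhds
    exact ge_of_tendsto ht (by filter_upwards [self_mem_nhdsWithin] with D hD using key D hD)
  · intro hk
    exact iInf₂_le C fun A => hk.exists_schurProduct A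

theorem SchurBdd.isSchurMultiplier {k : X → X → ℂ} {C : ℝ≥0} (hk : SchurBdd k C) :
    IsSchurMultiplier k := fun A => (hk.exists_schurProduct A).imp fun _ h => h.1

end Operators

/-! ### Products, relabelling and block-diagonal restriction -/

section Permanence

variable {X Y P Q : Type*}

theorem SchurBdd.mul {k l : X → Y → ℂ} {C D : ℝ} (hk : SchurBdd k C) (hl : SchurBdd l D)
    (hD : 0 ≤ D) : SchurBdd (fun x y => k x y * l x y) (C * D) := by
  intro a c hc ha
  have := hk _ _ (by positivity) (hl a c hc ha)
  simpa only [mul_assoc] using this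

theorem sum_sq_mul_comp_le [DecidableEq P] (γ : X → P) (F : Finset X) (F' : Finset P) (u : X → ℂ)
    (η : P → ℂ) (hu : ∀ p, ∑ x ∈ F with γ x = p, ‖u x‖ ^ 2 ≤ 1) :
    ∑ x ∈ F with γ x ∈ F', ‖u x * η (γ x)‖ ^ 2 ≤ ∑ p ∈ F', ‖η p‖ ^ 2 := by
  rw [← Finset.sum_fiberwise_eq_sum_filter]
  refine Finset.sum_le_sum fun p _ => ?_
  calc ∑ x ∈ F with γ x = p, ‖u x * η (γ x)‖ ^ 2
      = (∑ x ∈ F with γ x = p, ‖u x‖ ^ 2) * ‖η p‖ ^ 2 := by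
        rw [Finset.sum_mul]
        refine Finset.sum_congr rfl fun x hx => ?_
        rw [(Finset.mem_filter.1 hx).2, norm_mul, mul_pow]
    _ ≤ 1 * ‖η p‖ ^ 2 := by gcongr; exact hu p
    _ = _ := one_mul _

/-- The vectors `∑ u(x)δ_x` over the fibres of `α` are orthogonal with norm at most 1, so they
define a contraction, and likewise for `β` and `v`. The new matrix is `a` between these two
contractions. -/
theorem MatBdd.compress {a : X → Y → ℂ} {c : ℝ} (hc : 0 ≤ c) (ha : MatBdd a c)
    (α : X → P) (β : Y → Q) [DecidableEq P] [DecidableEq Q] (F : Finset X) (E : Finset Y)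
    (u : X → ℂ) (v : Y → ℂ) (hu : ∀ p, ∑ x ∈ F with α x = p, ‖u x‖ ^ 2 ≤ 1)
    (hv : ∀ q, ∑ y ∈ E with β y = q, ‖v y‖ ^ 2 ≤ 1) :
    MatBdd (fun p q => ∑ x ∈ F with α x = p, ∑ y ∈ E with β y = q, a x y * (u x * v y)) c := by
  intro F' E' η ξ
  have h1 : ∑ p ∈ F', ∑ q ∈ E', (∑ x ∈ F with α x = p, ∑ y ∈ E with β y = q,
      a x y * (u x * v y)) * (η p * ξ q) =
      ∑ x ∈ F with α x ∈ F', ∑ y ∈ E with β y ∈ E',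
        a x y * ((u x * η (α x)) * (v y * ξ (β y))) := by
    rw [← Finset.sum_fiberwise_eq_sum_filter]
    refine Finset.sum_congr rfl fun p _ => ?_
    simp_rw [Finset.sum_mul]
    rw [Finset.sum_comm]
    refine Finset.sum_congr rfl fun x hx => ?_
    rw [← Finset.sum_fiberwise_eq_sum_filter]
    refine Finset.sum_congr rfl fun q _ => Finset.sum_congr rfl fun y hy => ?_
    rw [(Finset.mem_filter.1 hx).2, (Finset.mem_filter.1 hy).2]
    ring
  rw [h1]
  refine (ha _ _ _ _).trans ?_
  refine mul_le_mul_of_nonneg_left ?_ hc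
  have := sum_sq_mul_comp_le α F F' u η hu
  have := sum_sq_mul_comp_le β E E' v ξ hv
  linarith

open Classical in
theorem exists_fibrewise_normalization (γ : X → P) (F : Finset X) (η : X → ℂ) :
    ∃ (M : P → ℝ) (u : X → ℂ), (∀ x ∈ F, η x = u x * M (γ x)) ∧
      (∀ p, ∑ x ∈ F with γ x = p, ‖u x‖ ^ 2 ≤ 1) ∧
      ∑ p ∈ F.image γ, ‖(M p : ℂ)‖ ^ 2 = ∑ x ∈ F, ‖η x‖ ^ 2 := by
  set S : P → ℝ := fun p => ∑ x ∈ F with γ x = p, ‖η x‖ ^ 2 with hS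
  have hS0 : ∀ p, 0 ≤ S p := fun p => by positivity
  -- `M` is the norm of `η` on each fibre. Where it vanishes, division by zero makes `u` zero,
  -- consistent with `η = 0` there.
  refine ⟨fun p => √(S p), fun x => η x / (√(S (γ x)) : ℝ), fun x hx => ?_, fun p => ?_, ?_⟩
  · by_cases h : √(S (γ x)) = 0
    · rw [Real.sqrt_eq_zero (hS0 _), hS,
        Finset.sum_eq_zero_iff_of_nonneg (fun _ _ => by positivity)] at h
      have := h x (Finset.mem_filter.2 ⟨hx, rfl⟩)
      have : η x = 0 := by simpa using this
      simp [this]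
    · rw [div_mul_cancel₀]
      exact_mod_cast h
  · have : ∑ x ∈ F with γ x = p, ‖η x / (√(S (γ x)) : ℝ)‖ ^ 2 = S p / S p := by
      conv_rhs => rw [hS, Finset.sum_div]
      refine Finset.sum_congr rfl fun x hx => ?_
      rw [(Finset.mem_filter.1 hx).2, norm_div, div_pow, Complex.norm_real,
        Real.norm_of_nonneg (Real.sqrt_nonneg _), Real.sq_sqrt (hS0 p)]
    rw [this]
    exact div_self_le_one _
  · rw [← Finset.sum_fiberwise_of_maps_to (fun x hx => Finset.mem_image_of_mem γ hx)]
    refine Finset.sum_congr rfl fun p _ => ?_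
    rw [Complex.norm_real, Real.norm_of_nonneg (Real.sqrt_nonneg _), Real.sq_sqrt (hS0 p)]

/-- For maps that are not injective, the fibrewise directions of `η` and `ξ` are absorbed into a
compression of `a`, and the fibrewise norms become the new vectors. Since `k` is constant on
products of fibres, both forms take the same value. -/
theorem SchurBdd.comp {k : P → Q → ℂ} {C : ℝ} (hk : SchurBdd k C) (α : X → P) (β : Y → Q) :
    SchurBdd (fun x y => k (α x) (β y)) C := by
  classical
  intro a c hc ha F E η ξ
  obtain ⟨M, u, hu1, hu2, hu3⟩ := exists_fibrewise_normalization α F η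
  obtain ⟨N, v, hv1, hv2, hv3⟩ := exists_fibrewise_normalization β E ξ
  have h := hk _ _ hc (ha.compress hc α β F E u v hu2 hv2) (F.image α) (E.image β)
    (fun p => M p) (fun q => N q)
  rw [hu3, hv3] at h
  refine le_trans (le_of_eq (congrArg norm ?_)) h
  rw [← Finset.sum_fiberwise_of_maps_to (fun x hx => Finset.mem_image_of_mem α hx)]
  refine Finset.sum_congr rfl fun p _ => ?_
  simp_rw [Finset.mul_sum, Finset.sum_mul]
  conv_rhs => rw [Finset.sum_comm]
  refine Finset.sum_congr rfl fun x hx => ?_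
  rw [← Finset.sum_fiberwise_of_maps_to (fun x hx => Finset.mem_image_of_mem β hx)]
  refine Finset.sum_congr rfl fun q _ => Finset.sum_congr rfl fun y hy => ?_
  rw [hu1 x (Finset.mem_filter.1 hx).1, hv1 y (Finset.mem_filter.1 hy).1,
    (Finset.mem_filter.1 hx).2, (Finset.mem_filter.1 hy).2]
  ring

open Classical in
-- The form decouples into diagonal blocks, and the symmetrised bounds of the blocks add up exactly
-- to the bound for the whole.
theorem schurBdd_pinching (r : X → P) (s : Y → P) :
    SchurBdd (fun x y => if r x = s y then (1 : ℂ) else 0) 1 := by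
  intro a c hc ha F E η ξ
  set R := F.image r ∪ E.image s
  have hF : ∀ x ∈ F, r x ∈ R := fun x hx => Finset.mem_union_left _ (Finset.mem_image_of_mem _ hx)
  have hE : ∀ y ∈ E, s y ∈ R := fun x hx => Finset.mem_union_right _ (Finset.mem_image_of_mem _ hx)
  rw [one_mul, ← Finset.sum_fiberwise_of_maps_to hF, ← Finset.sum_fiberwise_of_maps_to hF,
    ← Finset.sum_fiberwise_of_maps_to hE (fun y => ‖ξ y‖ ^ 2), ← Finset.sum_add_distrib,
    Finset.sum_div, Finset.mul_sum]
  refine (norm_sum_le _ _).trans (Finset.sum_le_sum fun p _ => ?_)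
  refine le_trans (le_of_eq (congrArg norm ?_)) (ha {x ∈ F | r x = p} {y ∈ E | s y = p} η ξ)
  refine Finset.sum_congr rfl fun x hx => ?_
  have hxp := (Finset.mem_filter.1 hx).2
  simp only [hxp, Finset.sum_filter]
  refine Finset.sum_congr rfl fun y _ => ?_
  by_cases h : p = s y
  · simp [h]
  · simp [h, Ne.symm h]

end Permanence

/-! ### Averages of Schur multipliers -/

section Integrals

variable {X Y P Q : Type*}

open Classical in
-- Draw one random point of `P` for each row and one of `Q` for each column, all independently. Each
-- entry is then the expectation of a relabelled copy of `k` over a single probability space, so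
-- `SchurBdd.comp` applies pointwise.
theorem SchurBdd.integral_prod [MeasurableSpace P] [MeasurableSpace Q] {k : P → Q → ℂ} {C M : ℝ}
    (hk : SchurBdd k C) (hkm : Measurable (Function.uncurry k)) (hM : ∀ p q, ‖k p q‖ ≤ M)
    (A : X → Measure P) (B : Y → Measure Q) [∀ x, IsProbabilityMeasure (A x)]
    [∀ y, IsProbabilityMeasure (B y)] :
    SchurBdd (fun x y => ∫ z, k z.1 z.2 ∂((A x).prod (B y))) C := by
  intro a c hc ha F E η ξ
  set μ := (Measure.pi fun x : F => A x).prod (Measure.pi fun y : E => B y)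
  -- Only rows in `F` enter the sum; outside `F` any point will do, and the probability measure
  -- supplies one.
  let α : ((F → P) × (E → Q)) → X → P := fun ω x =>
    if h : x ∈ F then ω.1 ⟨x, h⟩ else (nonempty_of_isProbabilityMeasure (A x)).some
  let β : ((F → P) × (E → Q)) → Y → Q := fun ω y =>
    if h : y ∈ E then ω.2 ⟨y, h⟩ else (nonempty_of_isProbabilityMeasure (B y)).some
  have hαβ : ∀ x ∈ F, ∀ y ∈ E, Measurable fun ω => k (α ω x) (β ω y) := by
    intro x hx y hy
    have : (fun ω => k (α ω x) (β ω y)) = Function.uncurry k ∘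
        fun ω : (F → P) × (E → Q) => (ω.1 ⟨x, hx⟩, ω.2 ⟨y, hy⟩) := by
      funext ω; simp [α, β, hx, hy]
    rw [this]
    exact hkm.comp (by fun_prop)
  have hint : ∀ x ∈ F, ∀ y ∈ E, Integrable (fun ω => k (α ω x) (β ω y)) μ := fun x hx y hy =>
    Integrable.of_bound (hαβ x hx y hy).aestronglyMeasurable M (Eventually.of_forall fun ω => hM _ _)
  have hkm' : Measurable fun z : P × Q => k z.1 z.2 := hkm
  have hval : ∀ x ∈ F, ∀ y ∈ E,
      ∫ z, k z.1 z.2 ∂((A x).prod (B y)) = ∫ ω, k (α ω x) (β ω y) ∂μ := by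
    intro x hx y hy
    have hp := (measurePreserving_eval (fun x : F => A x) ⟨x, hx⟩).prod
      (measurePreserving_eval (fun y : E => B y) ⟨y, hy⟩)
    rw [← hp.map_eq, integral_map hp.measurable.aemeasurable hkm'.aestronglyMeasurable]
    congr 1
    funext ω
    simp [α, β, hx, hy]
  have hsum : ∑ x ∈ F, ∑ y ∈ E,
      (∫ z, k z.1 z.2 ∂((A x).prod (B y))) * a x y * (η x * ξ y) =
      ∫ ω, ∑ x ∈ F, ∑ y ∈ E, k (α ω x) (β ω y) * a x y * (η x * ξ y) ∂μ := by
    rw [integral_finsetSum _ fun x hx => integrable_finsetSum _ fun y hy =>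
      ((hint x hx y hy).mul_const _).mul_const _]
    refine Finset.sum_congr rfl fun x hx => ?_
    rw [integral_finsetSum _ fun y hy => ((hint x hx y hy).mul_const _).mul_const _]
    refine Finset.sum_congr rfl fun y hy => ?_
    rw [integral_mul_const, integral_mul_const, hval x hx y hy]
  rw [hsum]
  refine (norm_integral_le_of_norm_le_const (Eventually.of_forall fun ω =>
    hk.comp (α ω) (β ω) a c hc ha F E η ξ)).trans ?_
  simp

/-- For each `z` the weights are moved onto the vectors, as `w z · η` and `v z · ξ`. Integrating the
symmetrised bounds leaves only the L² norms of the weights, so `μ` itself may be infinite. -/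
theorem SchurBdd.integral_weighted {Z : Type*} [MeasurableSpace Z] {μ : Measure Z}
    {k : Z → X → Y → ℂ} {C : ℝ} (hC : 0 ≤ C) (hk : ∀ z, SchurBdd (k z) C)
    {w : Z → X → ℝ} {v : Z → Y → ℝ} (hw : ∀ x, Integrable (fun z => w z x ^ 2) μ)
    (hv : ∀ y, Integrable (fun z => v z y ^ 2) μ) (hw1 : ∀ x, ∫ z, w z x ^ 2 ∂μ ≤ 1)
    (hv1 : ∀ y, ∫ z, v z y ^ 2 ∂μ ≤ 1)
    (hint : ∀ x y, Integrable (fun z => ((w z x * v z y : ℝ) : ℂ) * k z x y) μ) :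
    SchurBdd (fun x y => ∫ z, ((w z x * v z y : ℝ) : ℂ) * k z x y ∂μ) C := by
  intro a c hc ha F E η ξ
  have hsum : ∑ x ∈ F, ∑ y ∈ E,
      (∫ z, ((w z x * v z y : ℝ) : ℂ) * k z x y ∂μ) * a x y * (η x * ξ y) =
      ∫ z, ∑ x ∈ F, ∑ y ∈ E, k z x y * a x y * ((w z x * η x) * (v z y * ξ y)) ∂μ := by
    have hi : ∀ x y, Integrable (fun z => k z x y * a x y * ((w z x * η x) * (v z y * ξ y))) μ := by
      intro x y
      refine ((hint x y).mul_const (a x y * (η x * ξ y))).congr (Eventually.of_forall fun z => ?_)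
      push_cast
      ring
    rw [integral_finsetSum _ fun x hx => integrable_finsetSum _ fun y hy => hi x y]
    refine Finset.sum_congr rfl fun x hx => ?_
    rw [integral_finsetSum _ fun y hy => hi x y]
    refine Finset.sum_congr rfl fun y hy => ?_
    rw [mul_assoc, ← integral_mul_const]
    congr 1
    funext z
    push_cast
    ring
  rw [hsum]
  have hi1 : Integrable (fun z => ∑ x ∈ F, ‖(w z x * η x : ℂ)‖ ^ 2) μ := by
    refine integrable_finsetSum _ fun x _ => ?_
    simpa [mul_pow] using (hw x).mul_const (‖η x‖ ^ 2)
  have hi2 : Integrable (fun z => ∑ y ∈ E, ‖(v z y * ξ y : ℂ)‖ ^ 2) μ := by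
    refine integrable_finsetSum _ fun y _ => ?_
    simpa [mul_pow] using (hv y).mul_const (‖ξ y‖ ^ 2)
  have h1 : ∫ z, ∑ x ∈ F, ‖(w z x * η x : ℂ)‖ ^ 2 ∂μ ≤ ∑ x ∈ F, ‖η x‖ ^ 2 := by
    rw [integral_finsetSum _ fun x _ => by simpa [mul_pow] using (hw x).mul_const (‖η x‖ ^ 2)]
    refine Finset.sum_le_sum fun x _ => ?_
    have : ∀ z, ‖(w z x * η x : ℂ)‖ ^ 2 = w z x ^ 2 * ‖η x‖ ^ 2 := fun z => by simp [mul_pow]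
    simp_rw [this]
    rw [integral_mul_const]
    exact mul_le_of_le_one_left (by positivity) (hw1 x)
  have h2 : ∫ z, ∑ y ∈ E, ‖(v z y * ξ y : ℂ)‖ ^ 2 ∂μ ≤ ∑ y ∈ E, ‖ξ y‖ ^ 2 := by
    rw [integral_finsetSum _ fun y _ => by simpa [mul_pow] using (hv y).mul_const (‖ξ y‖ ^ 2)]
    refine Finset.sum_le_sum fun y _ => ?_
    have : ∀ z, ‖(v z y * ξ y : ℂ)‖ ^ 2 = v z y ^ 2 * ‖ξ y‖ ^ 2 := fun z => by simp [mul_pow]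
    simp_rw [this]
    rw [integral_mul_const]
    exact mul_le_of_le_one_left (by positivity) (hv1 y)
  refine (norm_integral_le_of_norm_le (((hi1.add hi2).div_const 2).const_mul (C * c))
    (Eventually.of_forall fun z => hk z a c hc ha F E _ _)).trans ?_
  simp only [Pi.add_apply]
  rw [integral_const_mul, integral_div, integral_add hi1 hi2]
  gcongr

theorem SchurBdd.integral {Z : Type*} [MeasurableSpace Z] {μ : Measure Z} [IsProbabilityMeasure μ]
    {k : Z → X → Y → ℂ} {C : ℝ} (hC : 0 ≤ C) (hk : ∀ z, SchurBdd (k z) C)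
    (hint : ∀ x y, Integrable (fun z => k z x y) μ) :
    SchurBdd (fun x y => ∫ z, k z x y ∂μ) C := by
  simpa using SchurBdd.integral_weighted (μ := μ) (w := fun _ _ => 1) (v := fun _ _ => 1) hC hk
    (by simp) (by simp) (by simp) (by simp) (by simpa using hint)

theorem exists_eq_smul_isProbabilityMeasure [MeasurableSpace P] [Nonempty P] (m : Measure P)
    [IsFiniteMeasure m] : ∃ m' : Measure P, IsProbabilityMeasure m' ∧ m = m Set.univ • m' := by
  by_cases h : m = 0
  -- The zero measure is zero times any point mass.
  · exact ⟨Measure.dirac (Classical.arbitrary P), inferInstance, by simp [h]⟩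
  · have : NeZero m := ⟨h⟩
    refine ⟨(m Set.univ)⁻¹ • m, inferInstance, ?_⟩
    rw [smul_smul, ENNReal.mul_inv_cancel (by simpa using h) (by finiteness), one_smul]

theorem SchurBdd.integral_prod_of_finite [MeasurableSpace P] [MeasurableSpace Q] {k : P → Q → ℂ}
    {C M : ℝ} (hk : SchurBdd k C) (hkm : Measurable (Function.uncurry k))
    (hM : ∀ p q, ‖k p q‖ ≤ M) [Nonempty P] [Nonempty Q]
    (A : X → Measure P) (B : Y → Measure Q) [∀ x, IsFiniteMeasure (A x)]
    [∀ y, IsFiniteMeasure (B y)] :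
    ∃ l : X → Y → ℂ, SchurBdd l C ∧ ∀ x y, ∫ z, k z.1 z.2 ∂((A x).prod (B y)) =
      (((A x).real Set.univ * (B y).real Set.univ : ℝ) : ℂ) * l x y := by
  choose A' hA' hA using fun x => exists_eq_smul_isProbabilityMeasure (A x)
  choose B' hB' hB using fun y => exists_eq_smul_isProbabilityMeasure (B y)
  refine ⟨_, hk.integral_prod hkm hM A' B', fun x y => ?_⟩
  conv_lhs => rw [hA x, hB y]
  rw [Measure.prod_smul_left, Measure.prod_smul_right, integral_smul_measure,
    integral_smul_measure, smul_smul, Complex.real_smul]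
  rfl

end Integrals

theorem tendsto_cocompact_zero_iff {X : Type*} [TopologicalSpace X] {f : X → ℂ} :
    Tendsto f (cocompact X) (𝓝 0) ↔ ∀ ε > 0, ∃ K, IsCompact K ∧ ∀ x ∉ K, ‖f x‖ < ε := by
  rw [hasBasis_cocompact.tendsto_iff Metric.nhds_basis_ball]
  simp

/-! ### Approximation on one compact set at a time -/

section NetBound

/-- Reformulation of `HasNetWithBound` by approximation on single compact sets. -/
def NetBound (G : Type*) [Group G] [TopologicalSpace G] (C : ℝ) : Prop :=
  ∀ L : Set G, IsCompact L → ∀ ε : ℝ, 0 < ε → ∃ f : G → ℂ, Continuous f ∧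
    Tendsto f (cocompact G) (𝓝 0) ∧ SchurBdd (hatKernel f) C ∧ ∀ x ∈ L, ‖f x - 1‖ < ε

variable {G : Type u} [Group G] [TopologicalSpace G]

theorem hasNetWithBound_iff {C : ℝ≥0} : HasNetWithBound G C ↔ NetBound G C := by
  constructor
  · rintro ⟨ι, _, _, _, f, -, h2, h3⟩ L hL ε hε
    obtain ⟨i, hi⟩ := ((Metric.tendstoUniformlyOn_iff.1 (h3 L hL)) ε hε).exists
    refine ⟨f i, map_continuous (f i), zero_at_infty (f i), schurNorm_le_iff.1 (h2 i),
      fun x hx => ?_⟩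
    have := hi x hx
    rwa [dist_comm, dist_eq_norm] at this
  · intro h
    -- Pairs of a compact set and a precision `1/(n+1)` index the net; they form a directed set in
    -- the universe of `G`.
    have h' : ∀ p : {L : Set G // IsCompact L} × ℕ, ∃ f : C₀(G, ℂ), SchurBdd (hatKernel f) C ∧
        ∀ x ∈ p.1.1, ‖f x - 1‖ < 1 / ((p.2 : ℝ) + 1) := by
      rintro ⟨⟨L, hL⟩, n⟩
      obtain ⟨f, hc, h0, hS, hf⟩ := h L hL (1 / ((n : ℝ) + 1)) (by positivity)
      exact ⟨⟨⟨f, hc⟩, h0⟩, hS, hf⟩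
    choose f hf1 hf2 using h'
    have hdir : IsDirected ({L : Set G // IsCompact L} × ℕ) (· ≤ ·) := by
      constructor
      rintro ⟨⟨L, hL⟩, n⟩ ⟨⟨L', hL'⟩, n'⟩
      exact ⟨⟨⟨L ∪ L', hL.union hL'⟩, max n n'⟩,
        ⟨Set.subset_union_left, le_max_left _ _⟩, ⟨Set.subset_union_right, le_max_right _ _⟩⟩
    refine ⟨{L : Set G // IsCompact L} × ℕ, inferInstance, hdir, ⟨⟨⟨∅, isCompact_empty⟩, 0⟩⟩, f,
      fun i => ⟨map_continuous (f i), (hf1 i).isSchurMultiplier⟩,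
      fun i => schurNorm_le_iff.2 (hf1 i), fun L hL => ?_⟩
    rw [Metric.tendstoUniformlyOn_iff]
    intro ε hε
    obtain ⟨n, hn⟩ := exists_nat_one_div_lt hε
    filter_upwards [eventually_ge_atTop (⟨⟨L, hL⟩, n⟩ : {L : Set G // IsCompact L} × ℕ)]
      with p hp x hx
    rw [dist_comm, dist_eq_norm]
    refine (hf2 p x (hp.1 hx)).trans_le (le_trans ?_ hn.le)
    have : (n : ℝ) ≤ p.2 := by exact_mod_cast hp.2
    gcongr

theorem NetBound.mono {C D : ℝ} (h : NetBound G C) (hCD : C ≤ D) : NetBound G D := by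
  intro L hL ε hε
  obtain ⟨f, h1, h2, h3, h4⟩ := h L hL ε hε
  exact ⟨f, h1, h2, h3.mono hCD, h4⟩

theorem weakHaagerupConst_le {C : ℝ≥0} (hC : 0 < C) (h : NetBound G C) :
    weakHaagerupConst G ≤ C := iInf₂_le C ⟨hC, hasNetWithBound_iff.2 h⟩

theorem netBound_of_weakHaagerupConst_lt {C : ℝ≥0} (h : weakHaagerupConst G < C) :
    NetBound G C := by
  simp only [weakHaagerupConst, iInf_lt_iff] at h
  obtain ⟨D, ⟨-, hD⟩, hlt⟩ := h
  exact (hasNetWithBound_iff.1 hD).mono (by exact_mod_cast hlt.le)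

theorem weakHaagerupConst_mono {H : Type*} [Group H] [TopologicalSpace H]
    (h : ∀ C : ℝ, 0 ≤ C → NetBound G C → NetBound H C) :
    (HasWeakHaagerup G → HasWeakHaagerup H) ∧ weakHaagerupConst H ≤ weakHaagerupConst G := by
  constructor
  · rintro ⟨C, hC, hG⟩
    exact ⟨C, hC, hasNetWithBound_iff.2 (h C C.2 (hasNetWithBound_iff.1 hG))⟩
  · exact le_iInf₂ fun C hC => weakHaagerupConst_le hC.1 (h C C.2 (hasNetWithBound_iff.1 hC.2))

theorem weakHaagerupConst_eq {H : Type*} [Group H] [TopologicalSpace H]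
    (h : ∀ C : ℝ, 0 ≤ C → (NetBound G C ↔ NetBound H C)) :
    (HasWeakHaagerup G ↔ HasWeakHaagerup H) ∧ weakHaagerupConst G = weakHaagerupConst H := by
  have h1 := weakHaagerupConst_mono (G := G) (H := H) fun C hC => (h C hC).1
  have h2 := weakHaagerupConst_mono (G := H) (H := G) fun C hC => (h C hC).2
  exact ⟨⟨h1.1, h2.1⟩, le_antisymm h2.2 h1.2⟩

theorem SchurBdd.norm_le {X Y : Type*} {k : X → Y → ℂ} {C : ℝ} (hk : SchurBdd k C) (x : X)
    (y : Y) : ‖k x y‖ ≤ C := by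
  classical
  have hm : MatBdd (fun (_ : Unit) (_ : Unit) => (1 : ℂ)) 1 := by
    intro F E η ξ
    rcases F.eq_empty_or_nonempty with rfl | ⟨i, hi⟩
    · simp; positivity
    rcases E.eq_empty_or_nonempty with rfl | ⟨j, hj⟩
    · simp; positivity
    obtain rfl : F = {()} := by ext; simpa using hi
    obtain rfl : E = {()} := by ext; simpa using hj
    simp only [Finset.sum_singleton, one_mul, norm_mul]
    nlinarith [sq_nonneg (‖η ()‖ - ‖ξ ()‖)]
  have := hk.comp (fun _ : Unit => x) (fun _ : Unit => y) _ 1 zero_le_one hm {()} {()}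
    (fun _ => 1) (fun _ => 1)
  simpa using this

theorem norm_le_of_schurBdd_hatKernel {A : Type*} [Group A] {f : A → ℂ} {C : ℝ}
    (hf : SchurBdd (hatKernel f) C) (x : A) :
    ‖f x‖ ≤ C := by
  simpa [hatKernel] using hf.norm_le x 1

/-- The value at the identity is nearly 1, while its modulus is at most the Schur constant. -/
theorem NetBound.one_le {C : ℝ} (h : NetBound G C) : 1 ≤ C := by
  refine le_of_forall_pos_le_add fun ε hε => ?_
  obtain ⟨f, -, -, h3, h4⟩ := h {1} isCompact_singleton ε hε
  have h5 := norm_le_of_schurBdd_hatKernel h3 1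
  have h6 := h4 1 rfl
  have h7 : ‖(1 : ℂ)‖ ≤ ‖f 1‖ + ‖f 1 - 1‖ := by
    have := norm_sub_le (f 1) (f 1 - 1)
    simpa using this
  rw [norm_one] at h7
  linarith

theorem one_le_weakHaagerupConst : 1 ≤ weakHaagerupConst G :=
  le_iInf₂ fun _ hC => by exact_mod_cast (hasNetWithBound_iff.1 hC.2).one_le

theorem hasWeakHaagerup_iff : HasWeakHaagerup G ↔ ∃ C : ℝ, NetBound G C := by
  constructor
  · rintro ⟨C, -, h⟩
    exact ⟨C, hasNetWithBound_iff.1 h⟩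
  · rintro ⟨C, h⟩
    have hC : 0 < C := zero_lt_one.trans_le h.one_le
    exact ⟨⟨C, hC.le⟩, hC, hasNetWithBound_iff.2 h⟩

end NetBound

/-! ### Closed embeddings, products and extension by zero -/

section Constructions

variable {G : Type*} [Group G] [TopologicalSpace G] {H : Type*} [Group H] [TopologicalSpace H]

theorem NetBound.of_isClosedEmbedding {C : ℝ} (h : NetBound G C) (φ : H →* G)
    (hφ : IsClosedEmbedding φ) : NetBound H C := by
  intro L hL ε hε
  obtain ⟨f, h1, h2, h3, h4⟩ := h (φ '' L) (hL.image hφ.continuous) ε hε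
  refine ⟨f ∘ φ, h1.comp hφ.continuous, h2.comp hφ.tendsto_cocompact, ?_,
    fun x hx => h4 _ (Set.mem_image_of_mem _ hx)⟩
  have : hatKernel (f ∘ φ) = fun x y => hatKernel f (φ x) (φ y) := by
    funext x y; simp [hatKernel]
  rw [this]
  exact h3.comp φ φ

theorem NetBound.prod {C D : ℝ} (hG : NetBound G C) (hH : NetBound H D) :
    NetBound (G × H) (C * D) := by
  intro L hL ε hε
  have hD : 0 ≤ D := zero_le_one.trans hH.one_le
  obtain ⟨δ, hδ, hδε⟩ : ∃ δ > 0, ∀ a b : ℂ, ‖a - 1‖ < δ → ‖b - 1‖ < δ → ‖a * b - 1‖ < ε := by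
    have hc : ContinuousAt (fun p : ℂ × ℂ => p.1 * p.2) (1, 1) := by fun_prop
    obtain ⟨δ, hδ, h⟩ := Metric.continuousAt_iff.1 hc ε hε
    refine ⟨δ, hδ, fun a b ha hb => ?_⟩
    have := @h (a, b) (by simpa [Prod.dist_eq, dist_eq_norm] using ⟨ha, hb⟩)
    simpa [dist_eq_norm] using this
  obtain ⟨f, f1, f2, f3, f4⟩ := hG (Prod.fst '' L) (hL.image continuous_fst) δ hδ
  obtain ⟨g, g1, g2, g3, g4⟩ := hH (Prod.snd '' L) (hL.image continuous_snd) δ hδ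
  refine ⟨fun p => f p.1 * g p.2, by fun_prop, ?_, ?_, fun x hx =>
    hδε _ _ (f4 _ (Set.mem_image_of_mem _ hx)) (g4 _ (Set.mem_image_of_mem _ hx))⟩
  -- Leaving compact sets in a product means that one coordinate does; that factor tends to zero
  -- while the other is bounded by its Schur constant.
  · rw [← coprod_cocompact, Filter.coprod]
    refine Tendsto.sup ?_ ?_
    · refine (f2.comp tendsto_comap).zero_mul_isBoundedUnder_le ?_
      exact isBoundedUnder_of ⟨D, fun x => norm_le_of_schurBdd_hatKernel g3 _⟩
    · refine isBoundedUnder_le_mul_tendsto_zero ?_ (g2.comp tendsto_comap)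
      exact isBoundedUnder_of ⟨C, fun x => norm_le_of_schurBdd_hatKernel f3 _⟩
  · exact (f3.comp Prod.fst Prod.fst).mul (g3.comp Prod.snd Prod.snd) hD

/-- The image is open and closed, so extension by zero stays continuous. Its kernel lives on pairs
in the same left coset, where coset representatives turn it into a relabelled copy of the kernel of
`f`; pinching removes the other pairs. -/
theorem exists_extension_of_isOpenEmbedding [IsTopologicalGroup G] {C : ℝ} (φ : H →* G)
    (hφ : IsOpenEmbedding φ) {f : H → ℂ} (h1 : Continuous f)
    (h2 : Tendsto f (cocompact H) (𝓝 0)) (h3 : SchurBdd (hatKernel f) C) :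
    ∃ g : G → ℂ, Continuous g ∧ Tendsto g (cocompact G) (𝓝 0) ∧ SchurBdd (hatKernel g) C ∧
      ∀ x, g (φ x) = f x := by
  classical
  have hg : ∀ x, Function.extend φ f 0 (φ x) = f x := fun x => hφ.injective.extend_apply _ _ _
  have hopen : IsOpen (φ.range : Set G) := by simpa using hφ.isOpen_range
  refine ⟨Function.extend φ f 0, ?_, ?_, ?_, hg⟩
  · rw [continuous_iff_continuousAt]
    intro x
    by_cases hx : x ∈ φ.range
    · obtain ⟨y, rfl⟩ := hx
      rw [← hφ.continuousAt_iff]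
      exact (h1.congr fun y => (hg y).symm).continuousAt
    · have : (φ.range : Set G)ᶜ ∈ 𝓝 x := (φ.range.isClosed_of_isOpen hopen).isOpen_compl.mem_nhds hx
      refine (continuousAt_const (y := (0 : ℂ))).congr ?_
      filter_upwards [this] with y hy
      exact (Function.extend_apply' f (0 : G → ℂ) y hy).symm
  · rw [tendsto_cocompact_zero_iff] at h2 ⊢
    intro ε hε
    obtain ⟨K, hK, hfK⟩ := h2 ε hε
    refine ⟨φ '' K, hK.image hφ.continuous, fun x hx => ?_⟩
    by_cases hxr : ∃ y, φ y = x
    · obtain ⟨y, rfl⟩ := hxr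
      rw [hg]
      exact hfK y fun hy => hx (Set.mem_image_of_mem _ hy)
    · rw [Function.extend_apply' _ _ _ hxr]
      simpa using hε
  -- With `x φ(b x)` the chosen representative, two points of one coset satisfy `y⁻¹x = φ(b y (b
  -- x)⁻¹)`.
  · have hex : ∀ x : G, ∃ h : H, (x : G ⧸ φ.range).out = x * φ h := fun x => by
      obtain ⟨⟨_, h, rfl⟩, hh⟩ := QuotientGroup.mk_out_eq_mul φ.range x
      exact ⟨h, hh⟩
    choose b hb using hex
    have key := (h3.comp (fun x => (b x)⁻¹) (fun x => (b x)⁻¹)).mul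
      (schurBdd_pinching (fun x : G => (x : G ⧸ φ.range)) (fun x : G => (x : G ⧸ φ.range)))
      zero_le_one
    rw [mul_one] at key
    convert key using 3 with x y
    simp only [hatKernel]
    split_ifs with hxy
    · have h4 := hb x
      rw [hxy, hb y] at h4
      have : y⁻¹ * x = φ ((b y)⁻¹⁻¹ * (b x)⁻¹) := by
        rw [map_mul, inv_inv, map_inv, eq_mul_inv_iff_mul_eq, mul_assoc, ← h4, inv_mul_cancel_left]
      rw [this, hg, mul_one]
    · rw [mul_zero]
      refine Function.extend_apply' _ _ _ fun h => hxy ?_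
      exact (QuotientGroup.eq.2 h).symm

end Constructions

/-! ### Quotients by compact normal subgroups -/

section CompactQuotient

variable {G : Type*} [Group G] [TopologicalSpace G] [IsTopologicalGroup G]
  [LocallyCompactSpace G]

theorem exists_isCompact_image_mk_superset (H : Subgroup G) {L : Set (G ⧸ H)} (hL : IsCompact L) :
    ∃ Q : Set G, IsCompact Q ∧ L ⊆ ((↑) : G → G ⧸ H) '' Q := by
  choose V hV hVn using fun x : G => exists_compact_mem_nhds x
  have hcov : L ⊆ ⋃ x : G, ((↑) : G → G ⧸ H) '' interior (V x) := by
    intro z _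
    obtain ⟨x, rfl⟩ := QuotientGroup.mk_surjective z
    exact Set.mem_iUnion.2 ⟨x, x, mem_interior_iff_mem_nhds.2 (hVn x), rfl⟩
  obtain ⟨t, ht⟩ := hL.elim_finite_subcover _
    (fun x => QuotientGroup.isOpenMap_coe _ isOpen_interior) hcov
  refine ⟨⋃ x ∈ t, V x, t.isCompact_biUnion fun x _ => hV x, fun z hz => ?_⟩
  obtain ⟨x, hx, y, hy, rfl⟩ := Set.mem_iUnion₂.1 (ht hz)
  exact ⟨y, Set.mem_biUnion hx (interior_subset hy), rfl⟩

theorem isCompact_preimage_mk (K : Subgroup G) [K.Normal] (hK : IsCompact (K : Set G))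
    (hKc : IsClosed (K : Set G)) {L : Set (G ⧸ K)} (hL : IsCompact L) :
    IsCompact (((↑) : G → G ⧸ K) ⁻¹' L) := by
  obtain ⟨Q, hQ, hQL⟩ := exists_isCompact_image_mk_superset K hL
  have : T3Space (G ⧸ K) := inferInstance
  refine (hQ.mul hK).of_isClosed_subset (hL.isClosed.preimage QuotientGroup.continuous_mk) ?_
  intro x hx
  obtain ⟨y, hy, hyx⟩ := hQL hx
  exact Set.mem_mul.2 ⟨y, hy, y⁻¹ * x, QuotientGroup.eq.1 hyx, mul_inv_cancel_left _ _⟩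

theorem NetBound.of_compact_quotient [T2Space G] (K : Subgroup G) [K.Normal]
    (hK : IsCompact (K : Set G)) {C : ℝ} (h : NetBound (G ⧸ K) C) : NetBound G C := by
  intro L hL ε hε
  obtain ⟨f, h1, h2, h3, h4⟩ := h _ (hL.image QuotientGroup.continuous_mk) ε hε
  refine ⟨fun x => f x, h1.comp QuotientGroup.continuous_mk, ?_, ?_,
    fun x hx => h4 _ (Set.mem_image_of_mem _ hx)⟩
  · rw [tendsto_cocompact_zero_iff] at h2 ⊢
    intro ε hε
    obtain ⟨Q, hQ, hfQ⟩ := h2 ε hε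
    exact ⟨_, isCompact_preimage_mk K hK hK.isClosed hQ, fun x hx => hfQ _ hx⟩
  · exact h3.comp (fun x : G => (x : G ⧸ K)) (fun x : G => (x : G ⧸ K))

theorem NetBound.compact_quotient [T2Space G] (K : Subgroup G) [K.Normal]
    (hK : IsCompact (K : Set G)) {C : ℝ} (h : NetBound G C) : NetBound (G ⧸ K) C := by
  have : CompactSpace K := isCompact_iff_compactSpace.1 hK
  let _ : MeasurableSpace K := borel K
  have : BorelSpace K := ⟨rfl⟩
  let K₀ : TopologicalSpace.PositiveCompacts K := ⊤
  let μ : Measure K := Measure.haarMeasure K₀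
  have : IsProbabilityMeasure μ := ⟨by
    have := Measure.haarMeasure_self (K₀ := K₀)
    simpa [K₀] using this⟩
  intro L hL ε hε
  -- Averaging turns strict bounds into weak ones, hence `ε / 2`.
  obtain ⟨f, h1, h2, h3, h4⟩ := h _ (isCompact_preimage_mk K hK hK.isClosed hL) (ε / 2)
    (half_pos hε)
  have hcont : ∀ g : G, Continuous fun k : K => f (g * k) := fun g => by fun_prop
  have hint : ∀ g : G, Integrable (fun k : K => f (g * k)) μ := fun g =>
    (hcont g).integrable_of_hasCompactSupport (HasCompactSupport.of_compactSpace _)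
  let F : G ⧸ K → ℂ := fun z => ∫ k : K, f (z.out * k) ∂μ
  have hF : ∀ g : G, F g = ∫ k : K, f (g * k) ∂μ := by
    intro g
    obtain ⟨k₀, hk₀⟩ := QuotientGroup.mk_out_eq_mul K g
    simp only [F, hk₀]
    have := integral_mul_left_eq_self (μ := μ) (fun k : K => f (g * k)) k₀
    simpa [mul_assoc] using this
  have hbound : ∀ (g : G) (c : ℂ) (δ : ℝ), (∀ k : K, ‖f (g * k) - c‖ ≤ δ) → ‖F g - c‖ ≤ δ := by
    intro g c δ hδ
    have h5 : F g - c = ∫ k : K, (f (g * k) - c) ∂μ := by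
      rw [integral_sub (hint g) (integrable_const _), hF]
      simp
    rw [h5]
    simpa using norm_integral_le_of_norm_le_const (μ := μ) (Eventually.of_forall hδ)
  refine ⟨F, ?_, ?_, ?_, ?_⟩
  · rw [QuotientGroup.isOpenQuotientMap_mk.isQuotientMap.continuous_iff]
    have : F ∘ ((↑) : G → G ⧸ K) = fun g => ∫ k : K, f (g * k) ∂μ := funext hF
    rw [this, ← continuousOn_univ]
    refine continuousOn_integral_of_compact_support (k := Set.univ) isCompact_univ ?_ (by simp)
    refine Continuous.continuousOn ?_
    simp only [Function.uncurry_def]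
    fun_prop
  · rw [tendsto_cocompact_zero_iff] at h2 ⊢
    intro ε hε
    obtain ⟨Q, hQ, hfQ⟩ := h2 (ε / 2) (half_pos hε)
    refine ⟨_, hQ.image QuotientGroup.continuous_mk, fun z hz => ?_⟩
    obtain ⟨g, rfl⟩ := QuotientGroup.mk_surjective z
    have := hbound g 0 (ε / 2) fun k => by
      rw [sub_zero]
      refine (hfQ _ fun hk => hz ⟨_, hk, ?_⟩).le
      rw [QuotientGroup.mk_mul_of_mem _ k.2]
    rw [sub_zero] at this
    linarith
  -- By normality `K` may be averaged on the row variable alone: `y.out⁻¹ * x.out * k` runs through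
  -- the coset of `y⁻¹x`.
  · have h6 := SchurBdd.integral (μ := μ) (zero_le_one.trans h.one_le)
      (fun k : K => h3.comp (fun x : G ⧸ K => x.out * k) (fun y : G ⧸ K => y.out))
      (fun x y => by simpa [hatKernel, mul_assoc] using hint (y.out⁻¹ * x.out))
    convert h6 using 3 with x y
    have : y⁻¹ * x = ((y.out⁻¹ * x.out : G) : G ⧸ K) := by simp
    rw [hatKernel, this, hF]
    simp [hatKernel, mul_assoc]
  · intro z hz
    obtain ⟨g, rfl⟩ := QuotientGroup.mk_surjective z
    have := hbound g 1 (ε / 2) fun k => (h4 _ (by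
      rw [Set.mem_preimage, QuotientGroup.mk_mul_of_mem _ k.2]; exact hz)).le
    linarith

end CompactQuotient

/-! ### Closed subgroups, finite products and directed unions -/

theorem netBound_closed_subgroup {G : Type*} [Group G] [TopologicalSpace G] {C : ℝ}
    (h : NetBound G C) (H : Subgroup G) (hH : IsClosed (H : Set G)) : NetBound H C :=
  h.of_isClosedEmbedding H.subtype hH.isClosedEmbedding_subtypeVal

theorem weakHaagerupConst_prod_le (G : Type u) [Group G] [TopologicalSpace G] (G' : Type v)
    [Group G'] [TopologicalSpace G'] :
    weakHaagerupConst (G × G') ≤ weakHaagerupConst G * weakHaagerupConst G' := by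
  have h1 : weakHaagerupConst G ≠ 0 := (zero_lt_one.trans_le one_le_weakHaagerupConst).ne'
  have h2 : weakHaagerupConst G' ≠ 0 := (zero_lt_one.trans_le one_le_weakHaagerupConst).ne'
  -- Both constants are at least 1, which excludes the products of 0 and ∞ where approximation from
  -- above would fail.
  refine ENNReal.le_mul_of_forall_lt (Or.inl h1) (Or.inr h2) fun c hc d hd => ?_
  rcases eq_or_ne c ∞ with rfl | hc'
  · rw [ENNReal.top_mul (zero_le.trans_lt hd).ne']
    exact le_top
  rcases eq_or_ne d ∞ with rfl | hd'
  · rw [ENNReal.mul_top (zero_le.trans_lt hc).ne']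
    exact le_top
  lift c to ℝ≥0 using hc'
  lift d to ℝ≥0 using hd'
  have h := (netBound_of_weakHaagerupConst_lt hc).prod (netBound_of_weakHaagerupConst_lt hd)
  rw [← NNReal.coe_mul] at h
  rw [← ENNReal.coe_mul]
  refine weakHaagerupConst_le ?_ h
  exact_mod_cast zero_lt_one.trans_le h.one_le

theorem netBound_of_compactSpace {G : Type*} [Group G] [TopologicalSpace G] [CompactSpace G] :
    NetBound G 1 := by
  intro L _ ε hε
  refine ⟨fun _ => 1, continuous_const, by simp, ?_, fun x _ => by simpa using hε⟩
  intro a c hc ha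
  simpa [hatKernel] using ha

theorem hasWeakHaagerup_pi (n : ℕ) (P : Fin n → Type v) [∀ i, Group (P i)]
    [∀ i, TopologicalSpace (P i)] (h : ∀ i, HasWeakHaagerup (P i)) :
    HasWeakHaagerup (∀ i, P i) := by
  induction n with
  | zero => exact hasWeakHaagerup_iff.2 ⟨1, netBound_of_compactSpace⟩
  | succ n ih =>
    obtain ⟨C, hC⟩ := hasWeakHaagerup_iff.1 (h 0)
    obtain ⟨D, hD⟩ := hasWeakHaagerup_iff.1 (ih (fun i => P i.succ) fun i => h i.succ)
    let φ : (∀ i, P i) →* P 0 × (∀ i : Fin n, P i.succ) :=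
      { toFun := fun f => (f 0, fun i => f i.succ)
        map_one' := rfl
        map_mul' := fun _ _ => rfl }
    let e : (∀ i, P i) ≃ₜ P 0 × (∀ i : Fin n, P i.succ) :=
      { toFun := fun f => (f 0, fun i => f i.succ)
        invFun := fun p => Fin.cons p.1 p.2
        left_inv := fun f => Fin.cons_self_tail f
        right_inv := fun p => by simp
        continuous_toFun := by fun_prop
        continuous_invFun := by
          refine continuous_pi fun i => ?_
          refine Fin.cases ?_ (fun j => ?_) i
          · simpa using continuous_fst
          · simp only [Fin.cons_succ]
            fun_prop }
    exact hasWeakHaagerup_iff.2 ⟨C * D, (hC.prod hD).of_isClosedEmbedding φ e.isClosedEmbedding⟩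

theorem tendsto_weakHaagerupConst_iUnion {G : Type u} [Group G] [TopologicalSpace G]
    [IsTopologicalGroup G] {I : Type w} [Preorder I] [IsDirected I (· ≤ ·)] [Nonempty I]
    (U : I → Subgroup G) (hU : Monotone U) (hUo : ∀ i, IsOpen (U i : Set G))
    (V : Subgroup G) (hV : (V : Set G) = ⋃ i, (U i : Set G)) :
    Tendsto (fun i => weakHaagerupConst (U i)) atTop (𝓝 (weakHaagerupConst V)) := by
  have hincl : ∀ {A B : Subgroup G} (hAB : A ≤ B), IsOpen (A : Set G) →
      IsOpenEmbedding (Subgroup.inclusion hAB) ∧ IsClosedEmbedding (Subgroup.inclusion hAB) := by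
    intro A B hAB hA
    have h1 : IsEmbedding (Subgroup.inclusion hAB) := Topology.IsEmbedding.inclusion hAB
    have h2 : Set.range (Subgroup.inclusion hAB) = ((↑) : B → G) ⁻¹' A := by
      ext x
      constructor
      · rintro ⟨y, rfl⟩; exact y.2
      · intro hx; exact ⟨⟨x, hx⟩, rfl⟩
    refine ⟨⟨h1, ?_⟩, ⟨h1, ?_⟩⟩
    · rw [h2]; exact hA.preimage continuous_subtype_val
    · rw [h2]; exact (A.isClosed_of_isOpen hA).preimage continuous_subtype_val
  have hle : ∀ {A B : Subgroup G}, A ≤ B → IsOpen (A : Set G) →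
      weakHaagerupConst A ≤ weakHaagerupConst B := fun hAB hA =>
    (weakHaagerupConst_mono fun C _ h => h.of_isClosedEmbedding _ (hincl hAB hA).2).2
  have hUV : ∀ i, U i ≤ V := fun i x hx => by
    have : x ∈ (V : Set G) := hV ▸ Set.mem_iUnion.2 ⟨i, hx⟩
    exact this
  -- Open subgroups are closed, so the constants increase along the family and the limit is a
  -- supremum.
  have hsup : weakHaagerupConst V = ⨆ i, weakHaagerupConst (U i) := by
    refine le_antisymm (ENNReal.le_of_forall_pos_le_add fun δ hδ hlt => ?_)
      (iSup_le fun i => hle (hUV i) (hUo i))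
    set s := ⨆ i, weakHaagerupConst (U i) with hs
    lift s to ℝ≥0 using hlt.ne with s'
    rw [← ENNReal.coe_add]
    refine weakHaagerupConst_le (by positivity) fun L hL ε hε => ?_
    obtain ⟨i, hi⟩ := hL.elim_directed_cover (fun i => ((↑) : V → G) ⁻¹' (U i : Set G))
      (fun i => (hUo i).preimage continuous_subtype_val)
      (fun x _ => by
        have : (x : G) ∈ ⋃ i, (U i : Set G) := hV ▸ x.2
        obtain ⟨i, hi⟩ := Set.mem_iUnion.1 this
        exact Set.mem_iUnion.2 ⟨i, hi⟩)
      (directed_of_isDirected_le fun i j hij x hx => hU hij hx)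
    have hi' : weakHaagerupConst (U i) < ((s' + δ : ℝ≥0) : ℝ≥0∞) := by
      refine (le_iSup (fun i => weakHaagerupConst (U i)) i).trans_lt ?_
      rw [← hs]
      exact_mod_cast lt_add_of_pos_right s' hδ
    have hemb := (hincl (hUV i) (hUo i)).1
    obtain ⟨f, f1, f2, f3, f4⟩ := netBound_of_weakHaagerupConst_lt hi' _
      (hemb.isInducing.isCompact_preimage' hL fun x hx => ⟨⟨x, hi hx⟩, rfl⟩) ε hε
    obtain ⟨g, g1, g2, g3, g4⟩ := exists_extension_of_isOpenEmbedding _ hemb f1 f2 f3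
    refine ⟨g, g1, g2, g3, fun x hx => ?_⟩
    have h5 : Subgroup.inclusion (hUV i) ⟨x, hi hx⟩ = x := rfl
    rw [← h5, g4]
    exact f4 _ hx
  rw [hsup]
  exact tendsto_atTop_iSup fun i j hij => hle (hU hij) (hUo i)

/-! ### Induction of multipliers from a closed subgroup -/

section Transfer

variable {G : Type*} [Group G] [TopologicalSpace G] {H : Subgroup G} [MeasurableSpace H]

/-- The integral of a function over the left coset `pH`, as a function of the representative. -/
noncomputable def fibreIntegral (ν : Measure H) (W : G → ℝ) (p : G) : ℝ := ∫ k : H, W (p * k) ∂ν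

/-- The double integral of `f(l⁻¹k) W(pk) W(gpl)` over the pairs `(k, l)` in `H × H`. -/
noncomputable def fibreKernel (ν : Measure H) (W : G → ℝ) (f : H → ℂ) (g p : G) : ℂ :=
  ∫ z : H × H, ((W (p * z.1) * W (g * p * z.2) : ℝ) : ℂ) * f (z.2⁻¹ * z.1) ∂(ν.prod ν)

/-- The function on `G` induced from a function `f` on `H` by means of a weight `W` on `G` and a
measure on `G ⧸ H`. -/
noncomputable def transfer [MeasurableSpace (G ⧸ H)] (μ : Measure (G ⧸ H)) (ν : Measure H) (W : G → ℝ)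
    (f : H → ℂ) (g : G) : ℂ :=
  ∫ z : G ⧸ H, fibreKernel ν W f g z.out ∂μ

variable [IsTopologicalGroup G]

/-- For `p` in `V`, only these `k` can bring `pk` into `S`. This gives locally uniform compact
supports for all integrals over fibres. -/
theorem isCompact_fibre_support [T2Space G] (hH : IsClosed (H : Set G)) {V S : Set G}
    (hV : IsCompact V) (hS : IsCompact S) :
    IsCompact {k : H | (k : G) ∈ V⁻¹ * S} :=
  hH.isClosedEmbedding_subtypeVal.isCompact_preimage (hV.inv.mul hS)

variable [T2Space G] [LocallyCompactSpace G] [SecondCountableTopology G] [BorelSpace H]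
  [SecondCountableTopology H] [LocallyCompactSpace H] {ν : Measure H} [ν.IsHaarMeasure] {W : G → ℝ}

theorem continuous_fibreIntegral (hH : IsClosed (H : Set G)) (hW : Continuous W)
    (hWc : HasCompactSupport W) : Continuous (fibreIntegral ν W) := by
  rw [continuous_iff_continuousAt]
  intro p
  obtain ⟨V, hV, hpV⟩ := exists_compact_mem_nhds p
  refine ContinuousOn.continuousAt (s := V) ?_ hpV
  refine continuousOn_integral_of_compact_support
    (isCompact_fibre_support hH hV hWc.isCompact) ?_ ?_
  · refine Continuous.continuousOn ?_
    simp only [Function.uncurry_def]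
    fun_prop
  · intro p k hp hk
    by_contra hne
    exact hk (Set.mem_mul.2 ⟨p⁻¹, Set.inv_mem_inv.2 hp, p * k, subset_tsupport _ hne, by simp⟩)

theorem continuous_fibreKernel (hH : IsClosed (H : Set G)) (hW : Continuous W)
    (hWc : HasCompactSupport W) {f : H → ℂ} (hf : Continuous f) :
    Continuous (Function.uncurry (fibreKernel ν W f)) := by
  rw [continuous_iff_continuousAt]
  rintro ⟨g, p⟩
  obtain ⟨V, hV, hgV⟩ := exists_compact_mem_nhds g
  obtain ⟨V', hV', hpV'⟩ := exists_compact_mem_nhds p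
  refine ContinuousOn.continuousAt (s := V ×ˢ V') ?_ (prod_mem_nhds hgV hpV')
  simp only [Function.uncurry_def, fibreKernel]
  refine continuousOn_integral_of_compact_support
    (f := fun (q : G × G) (z : H × H) =>
      ((W (q.2 * z.1) * W (q.1 * q.2 * z.2) : ℝ) : ℂ) * f (z.2⁻¹ * z.1))
    ((isCompact_fibre_support hH hV' hWc.isCompact).prod
    (isCompact_fibre_support hH (hV.mul hV') hWc.isCompact)) ?_ ?_
  · refine Continuous.continuousOn ?_
    simp only [Function.uncurry_def]
    fun_prop
  · rintro ⟨g, p⟩ ⟨k, l⟩ ⟨hg, hp⟩ hk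
    by_contra hne
    have h1 : W (p * k) ≠ 0 := fun h => hne (by simp [h])
    have h2 : W (g * p * l) ≠ 0 := fun h => hne (by simp [h])
    exact hk ⟨Set.mem_mul.2 ⟨p⁻¹, Set.inv_mem_inv.2 hp, p * k, subset_tsupport _ h1, by simp⟩,
      Set.mem_mul.2 ⟨(g * p)⁻¹, Set.inv_mem_inv.2 (Set.mul_mem_mul hg hp), g * p * l,
        subset_tsupport _ h2, by simp [mul_assoc]⟩⟩

theorem fibreIntegral_mul (p : G) (h : H) :
    fibreIntegral ν W (p * h) = fibreIntegral ν W p := by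
  have := integral_mul_left_eq_self (μ := ν) (fun k : H => W (p * k)) h
  simpa [fibreIntegral, mul_assoc] using this

/-- Translating `k` and `l` together by `h` leaves `l⁻¹k` unchanged, so left invariance of `ν`
suffices and the choice of coset representative is immaterial. -/
theorem fibreKernel_mul (f : H → ℂ) (g p : G) (h : H) :
    fibreKernel ν W f g (p * h) = fibreKernel ν W f g p := by
  have := integral_mul_left_eq_self (μ := ν.prod ν)
    (fun z : H × H => ((W (p * z.1) * W (g * p * z.2) : ℝ) : ℂ) * f (z.2⁻¹ * z.1)) (h, h)
  simpa [fibreKernel, mul_assoc] using this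

theorem mk_mul_out (g : G) (z : G ⧸ H) : ((g * z.out : G) : G ⧸ H) = g • z := by
  conv_rhs => rw [← QuotientGroup.out_eq' z]
  rfl

theorem fibreIntegral_out (p : G) :
    fibreIntegral ν W (p : G ⧸ H).out = fibreIntegral ν W p := by
  obtain ⟨h, hh⟩ := QuotientGroup.mk_out_eq_mul H p
  rw [hh, fibreIntegral_mul]

theorem fibreKernel_out (f : H → ℂ) (g p : G) :
    fibreKernel ν W f g (p : G ⧸ H).out = fibreKernel ν W f g p := by
  obtain ⟨h, hh⟩ := QuotientGroup.mk_out_eq_mul H p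
  rw [hh, fibreKernel_mul]

theorem continuous_fibreIntegral_out (hH : IsClosed (H : Set G)) (hW : Continuous W)
    (hWc : HasCompactSupport W) : Continuous fun z : G ⧸ H => fibreIntegral ν W z.out := by
  rw [QuotientGroup.isOpenQuotientMap_mk.isQuotientMap.continuous_iff]
  exact (continuous_fibreIntegral hH hW hWc).congr fun p => (fibreIntegral_out p).symm

theorem continuous_fibreKernel_out (hH : IsClosed (H : Set G)) (hW : Continuous W)
    (hWc : HasCompactSupport W) {f : H → ℂ} (hf : Continuous f) :
    Continuous fun q : G × (G ⧸ H) => fibreKernel ν W f q.1 q.2.out := by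
  rw [← (IsOpenQuotientMap.id.prodMap QuotientGroup.isOpenQuotientMap_mk).continuous_comp_iff]
  exact (continuous_fibreKernel hH hW hWc hf).congr fun q => (fibreKernel_out f q.1 q.2).symm

theorem fibreIntegral_out_eq_zero {z : G ⧸ H} (hz : z ∉ ((↑) : G → G ⧸ H) '' tsupport W) :
    fibreIntegral ν W z.out = 0 := by
  have : ∀ k : H, W (z.out * k) = 0 := fun k => by
    by_contra hne
    exact hz ⟨_, subset_tsupport _ hne, by
      rw [QuotientGroup.mk_mul_of_mem _ k.2, QuotientGroup.out_eq']⟩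
  simp [fibreIntegral, this]

theorem fibreKernel_out_eq_zero {f : H → ℂ} {g : G} {z : G ⧸ H}
    (hz : z ∉ ((↑) : G → G ⧸ H) '' tsupport W) : fibreKernel ν W f g z.out = 0 := by
  have : ∀ k : H, W (z.out * k) = 0 := fun k => by
    by_contra hne
    exact hz ⟨_, subset_tsupport _ hne, by
      rw [QuotientGroup.mk_mul_of_mem _ k.2, QuotientGroup.out_eq']⟩
  simp [fibreKernel, this]

theorem hasCompactSupport_fibre_weight (hH : IsClosed (H : Set G)) (hWc : HasCompactSupport W)
    (p : G) : HasCompactSupport fun k : H => W (p * k) := by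
  refine HasCompactSupport.intro (isCompact_fibre_support hH (isCompact_singleton (x := p))
    hWc.isCompact) fun k hk => ?_
  by_contra hne
  exact hk (Set.mem_mul.2 ⟨p⁻¹, by simp, p * k, subset_tsupport _ hne, by simp⟩)

theorem integrable_fibre_weight (hH : IsClosed (H : Set G)) (hW : Continuous W)
    (hWc : HasCompactSupport W) (p : G) : Integrable (fun k : H => W (p * k)) ν :=
  Continuous.integrable_of_hasCompactSupport (by fun_prop) (hasCompactSupport_fibre_weight hH hWc p)

theorem integrable_fibreKernel_integrand (hH : IsClosed (H : Set G)) (hW : Continuous W)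
    (hWc : HasCompactSupport W) {f : H → ℂ} (hf : Continuous f) (g p : G) :
    Integrable (fun z : H × H =>
      ((W (p * z.1) * W (g * p * z.2) : ℝ) : ℂ) * f (z.2⁻¹ * z.1)) (ν.prod ν) := by
  refine Continuous.integrable_of_hasCompactSupport (by fun_prop) ?_
  refine HasCompactSupport.intro ((hasCompactSupport_fibre_weight hH hWc p).isCompact.prod
    (hasCompactSupport_fibre_weight hH hWc (g * p)).isCompact) ?_
  rintro ⟨k, l⟩ hkl
  by_contra hne
  exact hkl ⟨subset_tsupport _ fun h => hne (by simp [h]),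
    subset_tsupport _ fun h => hne (by simp [h])⟩

theorem fibreKernel_one (g p : G) :
    fibreKernel ν W (fun _ => 1) g p = ((fibreIntegral ν W p * fibreIntegral ν W (g * p) : ℝ) : ℂ) := by
  simp only [fibreKernel, mul_one, fibreIntegral]
  rw [integral_complex_ofReal]
  congr 1
  exact integral_prod_mul (fun k : H => W (p * k)) (fun l : H => W (g * p * l))

/-- If both weights are nonzero then `l⁻¹k = (gpl)⁻¹ g (pk)` lies in `S⁻¹gS` with `S` the support of
`W`; only those values of `f` matter. -/
theorem norm_fibreKernel_le (hH : IsClosed (H : Set G)) (hW : Continuous W)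
    (hWc : HasCompactSupport W) (hW0 : ∀ x, 0 ≤ W x) {f : H → ℂ} {g : G} {ε : ℝ}
    (hf : ∀ r : H, (r : G) ∈ (tsupport W)⁻¹ * {g} * tsupport W → ‖f r‖ ≤ ε) (p : G) :
    ‖fibreKernel ν W f g p‖ ≤ ε * (fibreIntegral ν W p * fibreIntegral ν W (g * p)) := by
  have h1 : ε * (fibreIntegral ν W p * fibreIntegral ν W (g * p)) =
      ∫ z : H × H, ε * (W (p * z.1) * W (g * p * z.2)) ∂(ν.prod ν) := by
    rw [integral_const_mul]
    congr 1
    exact (integral_prod_mul (fun k : H => W (p * k)) (fun l : H => W (g * p * l))).symm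
  rw [h1, fibreKernel]
  refine norm_integral_le_of_norm_le (((integrable_fibre_weight hH hW hWc p).mul_prod
    (integrable_fibre_weight hH hW hWc (g * p))).const_mul ε) (Eventually.of_forall ?_)
  rintro ⟨k, l⟩
  rw [norm_mul, Complex.norm_real, Real.norm_of_nonneg (mul_nonneg (hW0 _) (hW0 _)), mul_comm]
  by_cases h : W (p * k) * W (g * p * l) = 0
  · simp [h]
  · refine mul_le_mul_of_nonneg_right (hf _ ?_) (mul_nonneg (hW0 _) (hW0 _))
    refine Set.mem_mul.2 ⟨(g * p * l)⁻¹ * g, Set.mul_mem_mul (Set.inv_mem_inv.2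
      (subset_tsupport _ (right_ne_zero_of_mul h))) rfl, p * k,
      subset_tsupport _ (left_ne_zero_of_mul h), ?_⟩
    simp only [Subgroup.coe_mul, Subgroup.coe_inv]
    group

variable [MeasurableSpace (G ⧸ H)] [BorelSpace (G ⧸ H)] [T2Space (G ⧸ H)] {μ : Measure (G ⧸ H)}
  [IsFiniteMeasureOnCompacts μ]

theorem continuous_transfer (hH : IsClosed (H : Set G)) (hW : Continuous W)
    (hWc : HasCompactSupport W) {f : H → ℂ} (hf : Continuous f) :
    Continuous (transfer μ ν W f) := by
  rw [← continuousOn_univ]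
  refine continuousOn_integral_of_compact_support
    (hWc.isCompact.image (QuotientGroup.continuous_mk (N := H)))
    (continuous_fibreKernel_out hH hW hWc hf).continuousOn ?_
  exact fun g z _ hz => fibreKernel_out_eq_zero hz

theorem integrable_fibreKernel_out (hH : IsClosed (H : Set G)) (hW : Continuous W)
    (hWc : HasCompactSupport W) {f : H → ℂ} (hf : Continuous f) (g : G) :
    Integrable (fun z : G ⧸ H => fibreKernel ν W f g z.out) μ := by
  refine Continuous.integrable_of_hasCompactSupport
    ((continuous_fibreKernel_out hH hW hWc hf).comp (Continuous.prodMk_right g)) ?_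
  exact HasCompactSupport.intro (hWc.isCompact.image (QuotientGroup.continuous_mk (N := H)))
    fun z hz => fibreKernel_out_eq_zero hz

theorem integrable_fibreIntegral_sq (hH : IsClosed (H : Set G)) (hW : Continuous W)
    (hWc : HasCompactSupport W) :
    Integrable (fun z : G ⧸ H => fibreIntegral ν W z.out ^ 2) μ := by
  refine Continuous.integrable_of_hasCompactSupport
    ((continuous_fibreIntegral_out hH hW hWc).pow 2) ?_
  exact HasCompactSupport.intro (hWc.isCompact.image (QuotientGroup.continuous_mk (N := H)))
    fun z hz => by rw [fibreIntegral_out_eq_zero hz]; simp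

theorem transfer_sub (hH : IsClosed (H : Set G)) (hW : Continuous W)
    (hWc : HasCompactSupport W) {f f' : H → ℂ} (hf : Continuous f) (hf' : Continuous f') (g : G) :
    transfer μ ν W (fun r => f r - f' r) g = transfer μ ν W f g - transfer μ ν W f' g := by
  rw [transfer, transfer, transfer, ← integral_sub (integrable_fibreKernel_out hH hW hWc hf g)
    (integrable_fibreKernel_out hH hW hWc hf' g)]
  congr 1
  funext z
  rw [fibreKernel, fibreKernel, fibreKernel,
    ← integral_sub (integrable_fibreKernel_integrand hH hW hWc hf g _)
    (integrable_fibreKernel_integrand hH hW hWc hf' g _)]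
  congr 1
  funext z
  ring

variable [SMulInvariantMeasure G (G ⧸ H) μ]

theorem integrable_fibreIntegral_mul (hH : IsClosed (H : Set G)) (hW : Continuous W)
    (hWc : HasCompactSupport W) (g : G) :
    Integrable (fun z : G ⧸ H => fibreIntegral ν W z.out * fibreIntegral ν W (g • z).out) μ := by
  have hc := continuous_fibreIntegral_out (ν := ν) hH hW hWc
  refine Continuous.integrable_of_hasCompactSupport
    (hc.mul (hc.comp (continuous_const_smul g))) ?_
  exact HasCompactSupport.intro (hWc.isCompact.image (QuotientGroup.continuous_mk (N := H)))
    fun z hz => by simp [fibreIntegral_out_eq_zero hz]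

theorem integrable_fibreIntegral_sq_smul (hH : IsClosed (H : Set G)) (hW : Continuous W)
    (hWc : HasCompactSupport W) (g : G) :
    Integrable (fun z : G ⧸ H => fibreIntegral ν W (g • z).out ^ 2) μ ∧
      ∫ z : G ⧸ H, fibreIntegral ν W (g • z).out ^ 2 ∂μ =
        ∫ z : G ⧸ H, fibreIntegral ν W z.out ^ 2 ∂μ :=
  have he : MeasurableEmbedding (fun z : G ⧸ H => g • z) :=
    (Homeomorph.smul g).measurableEmbedding
  ⟨((measurePreserving_smul g μ).integrable_comp_emb he).2 (integrable_fibreIntegral_sq hH hW hWc),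
    (measurePreserving_smul g μ).integral_comp he (fun z : G ⧸ H => fibreIntegral ν W z.out ^ 2)⟩

/-- The arithmetic–geometric inequality, together with invariance of `μ`. -/
theorem integral_fibreIntegral_mul_le (hH : IsClosed (H : Set G)) (hW : Continuous W)
    (hWc : HasCompactSupport W) (h1 : ∫ z : G ⧸ H, fibreIntegral ν W z.out ^ 2 ∂μ ≤ 1) (g : G) :
    ∫ z : G ⧸ H, fibreIntegral ν W z.out * fibreIntegral ν W (g • z).out ∂μ ≤ 1 := by
  obtain ⟨hi, he⟩ := integrable_fibreIntegral_sq_smul (μ := μ) (ν := ν) hH hW hWc g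
  have hi' := integrable_fibreIntegral_sq (μ := μ) (ν := ν) hH hW hWc
  calc ∫ z : G ⧸ H, fibreIntegral ν W z.out * fibreIntegral ν W (g • z).out ∂μ
      ≤ ∫ z : G ⧸ H, (fibreIntegral ν W z.out ^ 2 + fibreIntegral ν W (g • z).out ^ 2) / 2 ∂μ := by
        refine integral_mono (integrable_fibreIntegral_mul hH hW hWc g)
          ((hi'.add hi).div_const 2) fun z => ?_
        have := sq_nonneg (fibreIntegral ν W z.out - fibreIntegral ν W (g • z).out)
        simp only
        linarith
    _ ≤ 1 := by
        rw [integral_div, integral_add hi' hi, he]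
        linarith

theorem transfer_one (g : G) : transfer μ ν W (fun _ => 1) g =
    ((∫ z : G ⧸ H, fibreIntegral ν W z.out * fibreIntegral ν W (g • z).out ∂μ : ℝ) : ℂ) := by
  rw [transfer, ← integral_complex_ofReal]
  congr 1
  funext z
  rw [fibreKernel_one, ← fibreIntegral_out (g * z.out)]
  rw [mk_mul_out]

theorem norm_transfer_le (hH : IsClosed (H : Set G)) (hW : Continuous W)
    (hWc : HasCompactSupport W) (hW0 : ∀ x, 0 ≤ W x)
    (h1 : ∫ z : G ⧸ H, fibreIntegral ν W z.out ^ 2 ∂μ ≤ 1) {f : H → ℂ} {g : G} {ε : ℝ}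
    (hε : 0 ≤ ε) (hf : ∀ r : H, (r : G) ∈ (tsupport W)⁻¹ * {g} * tsupport W → ‖f r‖ ≤ ε) :
    ‖transfer μ ν W f g‖ ≤ ε := by
  have h2 := norm_integral_le_of_norm_le (μ := μ) (f := fun z : G ⧸ H => fibreKernel ν W f g z.out)
    ((integrable_fibreIntegral_mul (ν := ν) hH hW hWc g).const_mul ε)
    (Eventually.of_forall fun z => by
      refine (norm_fibreKernel_le hH hW hWc hW0 hf _).trans (le_of_eq ?_)
      rw [← fibreIntegral_out (g * z.out), mk_mul_out])
  rw [integral_const_mul] at h2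
  exact h2.trans (mul_le_of_le_one_right hε (integral_fibreIntegral_mul_le hH hW hWc h1 g))

/-- At `g = y⁻¹x` and base point `x⁻¹p` the second weight becomes `W(y⁻¹pl)`. Thus the measure in
`k` depends only on the row, that in `l` only on the column, and `l x y` is the average of the
kernel of `f` over the normalised measures. -/
theorem exists_schurBdd_fibreKernel (hH : IsClosed (H : Set G)) (hW : Continuous W)
    (hWc : HasCompactSupport W) (hW0 : ∀ x, 0 ≤ W x) {f : H → ℂ} (hf : Continuous f) {C : ℝ}
    (hfC : SchurBdd (hatKernel f) C) (p : G) :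
    ∃ l : G → G → ℂ, SchurBdd l C ∧ ∀ x y, fibreKernel ν W f (y⁻¹ * x) (x⁻¹ * p) =
      ((fibreIntegral ν W (x⁻¹ * p) * fibreIntegral ν W (y⁻¹ * p) : ℝ) : ℂ) * l x y := by
  have hm : ∀ q : G, Measurable fun k : H => ENNReal.ofReal (W (q * k)) := fun q =>
    (Continuous.measurable (by fun_prop)).ennreal_ofReal
  let A : G → Measure H := fun x => ν.withDensity fun k => ENNReal.ofReal (W (x⁻¹ * p * k))
  have hA : ∀ x, A x Set.univ = ENNReal.ofReal (fibreIntegral ν W (x⁻¹ * p)) := fun x => by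
    rw [withDensity_apply _ MeasurableSet.univ, Measure.restrict_univ, fibreIntegral,
      ofReal_integral_eq_lintegral_ofReal (integrable_fibre_weight hH hW hWc _)
      (Eventually.of_forall fun k => hW0 _)]
  have : ∀ x, IsFiniteMeasure (A x) := fun x => ⟨by rw [hA]; exact ENNReal.ofReal_lt_top⟩
  obtain ⟨l, hl, hl'⟩ := hfC.integral_prod_of_finite (M := C)
    (by
      have : Continuous (Function.uncurry (hatKernel f)) := by
        simp only [Function.uncurry_def, hatKernel]
        fun_prop
      exact this.measurable)
    (fun k l => norm_le_of_schurBdd_hatKernel hfC _) A A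
  refine ⟨l, hl, fun x y => ?_⟩
  have h0 : ∀ x, (A x).real Set.univ = fibreIntegral ν W (x⁻¹ * p) := fun x => by
    have : 0 ≤ fibreIntegral ν W (x⁻¹ * p) := integral_nonneg fun k => hW0 _
    rw [measureReal_def, hA, ENNReal.toReal_ofReal this]
  rw [← h0, ← h0, ← hl', prod_withDensity (hm _) (hm _),
    integral_withDensity_eq_integral_toReal_smul
      (show Measurable fun z : H × H => ENNReal.ofReal (W (x⁻¹ * p * z.1)) *
          ENNReal.ofReal (W (y⁻¹ * p * z.2)) from
        ((hm _).comp measurable_fst).mul ((hm _).comp measurable_snd))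
      (Eventually.of_forall fun z => ENNReal.mul_lt_top ENNReal.ofReal_lt_top ENNReal.ofReal_lt_top)]
  rw [fibreKernel]
  congr 1
  funext z
  rw [ENNReal.toReal_mul, ENNReal.toReal_ofReal (hW0 _), ENNReal.toReal_ofReal (hW0 _),
    Complex.real_smul, hatKernel]
  congr 4
  group

/-- The substitution `z ↦ x⁻¹z` puts the fibre kernel in the factored form above. The fibre masses
serve as weights, with L² norm at most 1 by invariance of `μ`. -/
theorem schurBdd_transfer (hH : IsClosed (H : Set G)) (hW : Continuous W)
    (hWc : HasCompactSupport W) (hW0 : ∀ x, 0 ≤ W x)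
    (h1 : ∫ z : G ⧸ H, fibreIntegral ν W z.out ^ 2 ∂μ ≤ 1) {f : H → ℂ} (hf : Continuous f) {C : ℝ}
    (hC : 0 ≤ C) (hfC : SchurBdd (hatKernel f) C) :
    SchurBdd (hatKernel (transfer μ ν W f)) C := by
  choose l hl hl' using fun z : G ⧸ H =>
    exists_schurBdd_fibreKernel (ν := ν) hH hW hWc hW0 hf hfC z.out
  have he : ∀ g : G, MeasurableEmbedding (fun z : G ⧸ H => g • z) := fun g =>
    (Homeomorph.smul g).measurableEmbedding
  have hk : ∀ (x y : G) (z : G ⧸ H), fibreKernel ν W f (y⁻¹ * x) (x⁻¹ • z).out =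
      ((fibreIntegral ν W (x⁻¹ • z).out * fibreIntegral ν W (y⁻¹ • z).out : ℝ) : ℂ) * l z x y := by
    intro x y z
    rw [← mk_mul_out, ← mk_mul_out, fibreKernel_out, fibreIntegral_out, fibreIntegral_out, hl']
  have key := SchurBdd.integral_weighted (μ := μ) (k := l)
    (w := fun z x => fibreIntegral ν W (x⁻¹ • z).out)
    (v := fun z y => fibreIntegral ν W (y⁻¹ • z).out) hC hl
    (fun x => (integrable_fibreIntegral_sq_smul hH hW hWc x⁻¹).1)
    (fun y => (integrable_fibreIntegral_sq_smul hH hW hWc y⁻¹).1)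
    (fun x => (integrable_fibreIntegral_sq_smul hH hW hWc x⁻¹).2.trans_le h1)
    (fun y => (integrable_fibreIntegral_sq_smul hH hW hWc y⁻¹).2.trans_le h1)
    (fun x y => by
      simp only [← hk]
      exact ((measurePreserving_smul x⁻¹ μ).integrable_comp_emb (he x⁻¹)).2
        (integrable_fibreKernel_out hH hW hWc hf (y⁻¹ * x)))
  convert key using 3 with x y
  simp only [← hk]
  exact ((measurePreserving_smul x⁻¹ μ).integral_comp (he x⁻¹)
    (fun z : G ⧸ H => fibreKernel ν W f (y⁻¹ * x) z.out)).symm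

theorem NetBound.of_transfer (hH : IsClosed (H : Set G)) (μ : Measure (G ⧸ H))
    [IsFiniteMeasureOnCompacts μ] [SMulInvariantMeasure G (G ⧸ H) μ] (ν : Measure H)
    [ν.IsHaarMeasure]
    (hex : ∀ L : Set G, IsCompact L → ∀ ε : ℝ, 0 < ε → ∃ W : G → ℝ, Continuous W ∧
      HasCompactSupport W ∧ (∀ x, 0 ≤ W x) ∧ ∫ z : G ⧸ H, fibreIntegral ν W z.out ^ 2 ∂μ ≤ 1 ∧
      ∀ g ∈ L, 1 - ε ≤
        ∫ z : G ⧸ H, fibreIntegral ν W z.out * fibreIntegral ν W (g • z).out ∂μ)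
    {C : ℝ} (h : NetBound H C) : NetBound G C := by
  intro L hL ε hε
  obtain ⟨W, hW, hWc, hW0, h1, hWL⟩ := hex L hL (ε / 3) (by positivity)
  have hS : IsCompact (tsupport W) := hWc
  -- `W` is fixed first; the induced function on `L` only sees `f` on `S⁻¹LS`, with `S` the support
  -- of `W`.
  obtain ⟨f, f1, f2, f3, f4⟩ := h {r : H | (r : G) ∈ (tsupport W)⁻¹ * L * tsupport W}
    (hH.isClosedEmbedding_subtypeVal.isCompact_preimage ((hS.inv.mul hL).mul hS)) (ε / 3)
    (by positivity)
  refine ⟨transfer μ ν W f, continuous_transfer hH hW hWc f1, ?_,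
    schurBdd_transfer hH hW hWc hW0 h1 f1 (zero_le_one.trans h.one_le) f3, fun g hg => ?_⟩
  · rw [tendsto_cocompact_zero_iff] at f2 ⊢
    intro δ hδ
    obtain ⟨Q, hQ, hfQ⟩ := f2 (δ / 2) (half_pos hδ)
    refine ⟨tsupport W * (((↑) : H → G) '' Q) * (tsupport W)⁻¹,
      (hS.mul (hQ.image continuous_subtype_val)).mul hS.inv, fun g hg => ?_⟩
    refine (norm_transfer_le hH hW hWc hW0 h1 (half_pos hδ).le fun r hr => ?_).trans_lt
      (half_lt_self hδ)
    refine (hfQ r fun hrQ => hg ?_).le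
    obtain ⟨a, ha, s, hs, har⟩ := Set.mem_mul.1 hr
    obtain ⟨t, ht, g', rfl, rfl⟩ := Set.mem_mul.1 ha
    refine Set.mem_mul.2 ⟨t⁻¹ * r, Set.mul_mem_mul (Set.mem_inv.1 ht) ⟨r, hrQ, rfl⟩, s⁻¹,
      Set.inv_mem_inv.2 hs, ?_⟩
    rw [← har]
    group
  -- The error splits into the function induced from `f - 1` and the defect of the one induced from
  -- 1, each at most `ε / 3`.
  · have h2 := norm_transfer_le (μ := μ) (ν := ν) (f := fun r => f r - 1) (g := g) hH hW hWc hW0 h1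
      (ε := ε / 3) (by positivity) fun r hr => (f4 r (by
        refine Set.mul_subset_mul_right (Set.mul_subset_mul_left ?_) hr
        simpa using hg)).le
    rw [transfer_sub hH hW hWc f1 continuous_const, transfer_one] at h2
    set I := ∫ z : G ⧸ H, fibreIntegral ν W z.out * fibreIntegral ν W (g • z).out ∂μ with hI
    have h3 : I ≤ 1 := integral_fibreIntegral_mul_le hH hW hWc h1 g
    have h4 : 1 - ε / 3 ≤ I := hWL g hg
    have h5 : ‖(I : ℂ) - 1‖ ≤ ε / 3 := by
      rw [← Complex.ofReal_one, ← Complex.ofReal_sub, Complex.norm_real, Real.norm_eq_abs, abs_le]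
      constructor <;> linarith
    have h6 : transfer μ ν W f g - 1 = (transfer μ ν W f g - I) + (I - 1) := by ring
    rw [h6]
    refine (norm_add_le _ _).trans_lt ?_
    linarith

end Transfer

theorem t2Space_quotient {G : Type*} [Group G] [TopologicalSpace G] [IsTopologicalGroup G]
    {H : Subgroup G} (hH : IsClosed (H : Set G)) : T2Space (G ⧸ H) := by
  rw [t2Space_iff_of_isOpenQuotientMap QuotientGroup.isOpenQuotientMap_mk]
  have : {q : G × G | (q.1 : G ⧸ H) = q.2} = (fun q : G × G => q.1⁻¹ * q.2) ⁻¹' H := by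
    ext q
    exact QuotientGroup.eq
  rw [this]
  exact hH.preimage (by fun_prop)

/-! ### Lifting functions from the coset space -/

section Lift

variable {G : Type*} [Group G] [TopologicalSpace G] {H : Subgroup G} [MeasurableSpace H]
  [IsTopologicalGroup G] [T2Space G] [LocallyCompactSpace G] [SecondCountableTopology G]
  [BorelSpace H] [SecondCountableTopology H] [LocallyCompactSpace H] {ν : Measure H}
  [ν.IsHaarMeasure]

/-- A bump `ψ` over the support of `h` is multiplied by `h` divided by the fibre integral of `ψ`,
which is constant on cosets. -/
theorem exists_fibreIntegral_eq (hH : IsClosed (H : Set G)) {h : G ⧸ H → ℝ} (hc : Continuous h)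
    (hs : HasCompactSupport h) (h0 : ∀ z, 0 ≤ h z) :
    ∃ W : G → ℝ, Continuous W ∧ HasCompactSupport W ∧ (∀ x, 0 ≤ W x) ∧
      ∀ z : G ⧸ H, fibreIntegral ν W z.out = h z := by
  obtain ⟨Q, hQ, hQh⟩ := exists_isCompact_image_mk_superset H (L := tsupport h) hs
  obtain ⟨ψ, hψ1, -, hψc, hψ01⟩ := exists_continuous_one_zero_of_isCompact hQ isClosed_empty
    (Set.disjoint_empty Q)
  have hψ0 : ∀ x, 0 ≤ ψ x := fun x => (hψ01 x).1
  have hpos : ∀ z ∈ tsupport h, 0 < fibreIntegral ν ψ z.out := by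
    intro z hz
    obtain ⟨q, hq, rfl⟩ := hQh hz
    rw [fibreIntegral_out]
    refine Continuous.integral_pos_of_hasCompactSupport_nonneg_nonzero (x := 1) (by fun_prop)
      (hasCompactSupport_fibre_weight hH hψc q) (fun k => hψ0 _) ?_
    simp [hψ1 hq]
  have hcont := continuous_fibreIntegral (ν := ν) hH ψ.continuous hψc
  -- The maximum with `c` keeps the denominator positive everywhere and changes nothing on the
  -- support of `h`.
  obtain ⟨c, hc0, hcle⟩ : ∃ c > 0, ∀ z ∈ tsupport h, c ≤ fibreIntegral ν ψ z.out := by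
    rcases (tsupport h).eq_empty_or_nonempty with he | hne
    · exact ⟨1, one_pos, by simp [he]⟩
    · obtain ⟨z, hz, hmin⟩ := IsCompact.exists_isMinOn hs hne
        (continuous_fibreIntegral_out (ν := ν) hH ψ.continuous hψc).continuousOn
      exact ⟨_, hpos z hz, fun w hw => hmin hw⟩
  have hmax : ∀ p, 0 < max (fibreIntegral ν ψ p) c := fun p => lt_max_of_lt_right hc0
  refine ⟨fun p => ψ p * (h p / max (fibreIntegral ν ψ p) c), ?_, hψc.mul_right, fun p =>
    mul_nonneg (hψ0 p) (div_nonneg (h0 _) (hmax p).le), fun z => ?_⟩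
  · refine ψ.continuous.mul ((hc.comp QuotientGroup.continuous_mk).div
      (hcont.max continuous_const) fun p => (hmax p).ne')
  · obtain ⟨p, rfl⟩ := QuotientGroup.mk_surjective z
    rw [fibreIntegral_out]
    have h1 : ∀ k : H, ψ (p * k) * (h (p * k : G) / max (fibreIntegral ν ψ (p * k)) c) =
        ψ (p * k) * (h p / max (fibreIntegral ν ψ p) c) := fun k => by
      rw [fibreIntegral_mul, QuotientGroup.mk_mul_of_mem _ k.2]
    rw [fibreIntegral]
    simp_rw [h1]
    rw [integral_mul_const]
    change fibreIntegral ν ψ p * _ = _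
    by_cases hp : (p : G ⧸ H) ∈ tsupport h
    · have h2 := hcle _ hp
      rw [fibreIntegral_out] at h2
      rw [max_eq_left h2, mul_div_cancel₀]
      exact (hc0.trans_le h2).ne'
    · rw [image_eq_zero_of_notMem_tsupport hp]
      simp

end Lift

/-! ### Almost invariant functions and lattices -/

section Approximation

variable {G : Type*} [Group G] [TopologicalSpace G] [IsTopologicalGroup G] [T2Space G]
  [LocallyCompactSpace G] [SecondCountableTopology G]

theorem NetBound.of_almost_invariant {H : Subgroup G} (hH : IsClosed (H : Set G))
    [MeasurableSpace (G ⧸ H)] [BorelSpace (G ⧸ H)] (μ : Measure (G ⧸ H))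
    [IsFiniteMeasureOnCompacts μ] [SMulInvariantMeasure G (G ⧸ H) μ]
    (hex : ∀ L : Set G, IsCompact L → ∀ ε : ℝ, 0 < ε → ∃ h : G ⧸ H → ℝ, Continuous h ∧
      HasCompactSupport h ∧ (∀ z, 0 ≤ h z) ∧ ∫ z, h z ^ 2 ∂μ ≤ 1 ∧
      ∀ g ∈ L, 1 - ε ≤ ∫ z, h z * h (g • z) ∂μ)
    {C : ℝ} (h : NetBound H C) : NetBound G C := by
  let _ : MeasurableSpace H := borel H
  have : BorelSpace H := ⟨rfl⟩
  have : LocallyCompactSpace H := hH.isClosedEmbedding_subtypeVal.locallyCompactSpace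
  have : SecondCountableTopology H := TopologicalSpace.Subtype.secondCountableTopology _
  have : T2Space (G ⧸ H) := t2Space_quotient hH
  refine NetBound.of_transfer hH μ Measure.haar (fun L hL ε hε => ?_) h
  obtain ⟨h, h1, h2, h3, h4, h5⟩ := hex L hL ε hε
  obtain ⟨W, hW1, hW2, hW3, hW4⟩ := exists_fibreIntegral_eq (ν := Measure.haar) hH h1 h2 h3
  exact ⟨W, hW1, hW2, hW3, by simpa only [hW4] using h4, by simpa only [hW4] using h5⟩

theorem NetBound.of_lattice {Γ : Subgroup G} (hΓ : IsLattice Γ) {C : ℝ} (h : NetBound Γ C) :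
    NetBound G C := by
  let _ : MeasurableSpace (G ⧸ Γ) := borel _
  have : BorelSpace (G ⧸ Γ) := ⟨rfl⟩
  obtain ⟨hd, μ, hμ0, hμf, hμ⟩ := hΓ
  have hH : IsClosed (Γ : Set G) := Subgroup.isClosed_of_discrete
  have : T2Space (G ⧸ Γ) := t2Space_quotient hH
  have : IsFiniteMeasure μ := ⟨hμf⟩
  have : NeZero μ := ⟨hμ0⟩
  set m : Measure (G ⧸ Γ) := (μ Set.univ)⁻¹ • μ with hm
  have : IsProbabilityMeasure m := inferInstance
  have : SMulInvariantMeasure G (G ⧸ Γ) m := ⟨fun g s hs => by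
    simp only [hm, Measure.smul_apply, hμ g s hs]⟩
  refine NetBound.of_almost_invariant hH m (fun L _ ε hε => ?_) h
  obtain ⟨K, hK, hKm⟩ : ∃ K : Set (G ⧸ Γ), IsCompact K ∧ 1 - ε / 2 < m.real K := by
    have ht := tendsto_measure_iUnion_atTop (μ := m) (compactCovering_subset (G ⧸ Γ))
    rw [iUnion_compactCovering, measure_univ] at ht
    have ht' := (ENNReal.tendsto_toReal ENNReal.one_ne_top).comp ht
    obtain ⟨n, hn⟩ := (ht'.eventually (lt_mem_nhds (a := 1 - ε / 2) (by simp [hε]))).exists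
    exact ⟨_, isCompact_compactCovering _ n, hn⟩
  obtain ⟨ψ, hψ1, -, hψc, hψ01⟩ := exists_continuous_one_zero_of_isCompact hK isClosed_empty
    (Set.disjoint_empty K)
  have hi : Integrable ψ m := ψ.continuous.integrable_of_hasCompactSupport hψc
  have hmp := fun g : G => measurePreserving_smul g m
  have he : ∀ g : G, MeasurableEmbedding (fun z : G ⧸ Γ => g • z) := fun g =>
    (Homeomorph.smul g).measurableEmbedding
  have hI : 1 - ε / 2 ≤ ∫ z, ψ z ∂m := by
    have h1 : m.real K = ∫ z, K.indicator 1 z ∂m := (integral_indicator_one hK.measurableSet).symm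
    refine hKm.le.trans (h1.trans_le (integral_mono ?_ hi fun z => ?_))
    · exact (integrable_const (1 : ℝ)).indicator hK.measurableSet
    · by_cases hz : z ∈ K
      · simp [hz, hψ1 hz]
      · simpa [hz] using (hψ01 z).1
  refine ⟨ψ, ψ.continuous, hψc, fun z => (hψ01 z).1, ?_, fun g _ => ?_⟩
  · have : ∫ z, ψ z ^ 2 ∂m ≤ ∫ z, (1 : ℝ) ∂m := by
      refine integral_mono_of_nonneg (Eventually.of_forall fun z => sq_nonneg _)
        (integrable_const _) (Eventually.of_forall fun z => ?_)
      exact pow_le_one₀ (hψ01 z).1 (hψ01 z).2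
    simpa using this
  · have hig : Integrable (fun z => ψ (g • z)) m := ((hmp g).integrable_comp_emb (he g)).2 hi
    have hie : ∫ z, ψ (g • z) ∂m = ∫ z, ψ z ∂m := (hmp g).integral_comp (he g) ψ
    -- Since `(1 - ψ(z))(1 - ψ(gz)) ≥ 0`, the product dominates `ψ(z) + ψ(gz) - 1`; each of the two
    -- integrals loses at most `ε / 2`.
    calc 1 - ε ≤ ∫ z, (ψ z + ψ (g • z) - 1) ∂m := by
          have h1 : ∫ z, (ψ z + ψ (g • z) - 1) ∂m = ∫ z, (ψ z + ψ (g • z)) ∂m - ∫ z, (1 : ℝ) ∂m :=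
            integral_sub (hi.add hig) (integrable_const _)
          rw [h1, integral_add hi hig, hie]
          simp
          linarith
      _ ≤ ∫ z, ψ z * ψ (g • z) ∂m := by
          refine integral_mono ((hi.add hig).sub (integrable_const _)) ?_ fun z => ?_
          · refine Continuous.integrable_of_hasCompactSupport
              (ψ.continuous.mul (ψ.continuous.comp (continuous_const_smul g))) hψc.mul_right
          · have := mul_nonneg (sub_nonneg.2 (hψ01 z).2) (sub_nonneg.2 (hψ01 (g • z)).2)
            simp only
            linarith

end Approximation

/-! ### Invariant means and smearing -/

section Mean

variable {Q : Type*} [Group Q] [TopologicalSpace Q] [IsTopologicalGroup Q]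

theorem HasCompactSupport.comp_mul_left {σ : Q → ℝ} (hσ : HasCompactSupport σ) (u : Q) :
    HasCompactSupport fun s => σ (u * s) :=
  hσ.comp_homeomorph (Homeomorph.mulLeft u)

/-- Left translation of bounded continuous functions. -/
noncomputable def translateBdd (g : Q) (F : Q →ᵇ ℝ) : Q →ᵇ ℝ :=
  F.compContinuous ⟨fun x => g * x, continuous_const_mul g⟩

/-- A left-invariant mean on an amenable group, as a continuous linear functional. -/
theorem IsAmenable.exists_mean (hQ : IsAmenable Q) :
    ∃ M : (Q →ᵇ ℝ) →L[ℝ] ℝ, M (BoundedContinuousFunction.const Q 1) = 1 ∧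
      (∀ (F : Q →ᵇ ℝ), (∀ x, 0 ≤ F x) → 0 ≤ M F) ∧
      ∀ (g : Q) (F : Q →ᵇ ℝ), M (translateBdd g F) = M F := by
  obtain ⟨m, hpos, hone, hinv⟩ := hQ
  have hle : ∀ F : Q →ᵇ ℝ, m F ≤ ‖F‖ := by
    intro F
    have h := hpos (‖F‖ • BoundedContinuousFunction.const Q 1 - F) fun x => by
      simpa using (le_abs_self _).trans (F.norm_coe_le_norm x)
    rw [map_sub, map_smul, hone, smul_eq_mul, mul_one] at h
    linarith
  refine ⟨m.mkContinuous 1 fun F => ?_, hone, hpos, hinv⟩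
  rw [one_mul, Real.norm_eq_abs, abs_le]
  have h1 := hle F
  have h2 := hle (-F)
  rw [map_neg, norm_neg] at h2
  constructor <;> linarith

variable [LocallyCompactSpace Q] [MeasurableSpace Q] [BorelSpace Q] {lam : Measure Q}
  [lam.IsHaarMeasure]

theorem norm_integral_mul_bdd_le {σ : Q → ℝ} (hσ : Continuous σ) (hσc : HasCompactSupport σ)
    (F : Q →ᵇ ℝ) (φ : Q → Q) : ‖∫ s, σ s * F (φ s) ∂lam‖ ≤ ‖F‖ * ∫ s, |σ s| ∂lam := by
  rw [← integral_const_mul]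
  refine norm_integral_le_of_norm_le
    ((hσ.abs.integrable_of_hasCompactSupport hσc.abs).const_mul _)
    (Eventually.of_forall fun s => ?_)
  rw [norm_mul, mul_comm, Real.norm_eq_abs (σ s)]
  exact mul_le_mul_of_nonneg_right (F.norm_coe_le_norm _) (abs_nonneg _)

/-- The function `t ↦ ∫ σ(s) F(θ(s)t) ds`. -/
noncomputable def smear (lam : Measure Q) [lam.IsHaarMeasure] (θ : C(Q, Q)) {σ : Q → ℝ}
    (hσ : Continuous σ) (hσc : HasCompactSupport σ) (F : Q →ᵇ ℝ) : Q →ᵇ ℝ :=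
  BoundedContinuousFunction.ofNormedAddCommGroup (fun t => ∫ s, σ s * F (θ s * t) ∂lam)
    (by
      rw [← continuousOn_univ]
      refine continuousOn_integral_of_compact_support (k := tsupport σ) hσc ?_ ?_
      · refine Continuous.continuousOn ?_
        simp only [Function.uncurry_def]
        fun_prop
      · intro t s _ hs
        rw [image_eq_zero_of_notMem_tsupport hs, zero_mul])
    (‖F‖ * ∫ s, |σ s| ∂lam) (fun t => norm_integral_mul_bdd_le hσ hσc F _)

theorem smear_apply (θ : C(Q, Q)) {σ : Q → ℝ} (hσ : Continuous σ) (hσc : HasCompactSupport σ)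
    (F : Q →ᵇ ℝ) (t : Q) : smear lam θ hσ hσc F t = ∫ s, σ s * F (θ s * t) ∂lam := rfl

theorem integrable_smear (θ : C(Q, Q)) {σ : Q → ℝ} (hσ : Continuous σ)
    (hσc : HasCompactSupport σ) (F : Q →ᵇ ℝ) (t : Q) :
    Integrable (fun s => σ s * F (θ s * t)) lam :=
  Continuous.integrable_of_hasCompactSupport (by fun_prop) hσc.mul_right

theorem norm_smear_sub_le (θ : C(Q, Q)) {σ τ : Q → ℝ} (hσ : Continuous σ)
    (hσc : HasCompactSupport σ) (hτ : Continuous τ) (hτc : HasCompactSupport τ) (F : Q →ᵇ ℝ) :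
    ‖smear lam θ hσ hσc F - smear lam θ hτ hτc F‖ ≤ ‖F‖ * ∫ s, |σ s - τ s| ∂lam := by
  refine (BoundedContinuousFunction.norm_le (mul_nonneg (norm_nonneg _)
    (integral_nonneg fun s => abs_nonneg _))).2 fun t => ?_
  rw [BoundedContinuousFunction.sub_apply, smear_apply, smear_apply,
    ← integral_sub (integrable_smear θ hσ hσc F t) (integrable_smear θ hτ hτc F t)]
  simp_rw [← sub_mul]
  exact norm_integral_mul_bdd_le (hσ.sub hτ) (hσc.sub hτc) F _

theorem tendsto_integral_abs_sub_translate {σ : Q → ℝ} (hσ : Continuous σ)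
    (hσc : HasCompactSupport σ) (u₀ : Q) :
    Tendsto (fun u => ∫ s, |σ (u * s) - σ (u₀ * s)| ∂lam) (𝓝 u₀) (𝓝 0) := by
  obtain ⟨V, hV, hVn⟩ := exists_compact_mem_nhds u₀
  have hu₀ : u₀ ∈ V := mem_of_mem_nhds hVn
  have hc : ContinuousOn (fun u => ∫ s, |σ (u * s) - σ (u₀ * s)| ∂lam) V := by
    refine continuousOn_integral_of_compact_support (k := V⁻¹ * tsupport σ)
      (hV.inv.mul hσc) ?_ ?_
    · refine Continuous.continuousOn ?_
      simp only [Function.uncurry_def]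
      fun_prop
    · intro u s hu hs
      have h0 : ∀ w ∈ V, σ (w * s) = 0 := fun w hw => by
        by_contra hne
        exact hs (Set.mem_mul.2 ⟨w⁻¹, Set.inv_mem_inv.2 hw, w * s, subset_tsupport _ hne, by simp⟩)
      simp [h0 u hu, h0 u₀ hu₀]
  have := (hc.continuousAt hVn).tendsto
  simpa using this

theorem continuous_smear_translate (θ : C(Q, Q)) {σ : Q → ℝ} (hσ : Continuous σ)
    (hσc : HasCompactSupport σ) (F : Q →ᵇ ℝ) :
    Continuous fun u => smear lam θ (hσ.comp (continuous_const_mul u))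
      (HasCompactSupport.comp_mul_left hσc u) F := by
  rw [continuous_iff_continuousAt]
  intro u₀
  rw [ContinuousAt, tendsto_iff_norm_sub_tendsto_zero]
  have h := (tendsto_integral_abs_sub_translate (lam := lam) hσ hσc u₀).const_mul ‖F‖
  rw [mul_zero] at h
  exact squeeze_zero (fun _ => norm_nonneg _) (fun u => norm_smear_sub_le θ _ _ _ _ F) h

theorem eq_zero_of_forall_integral_mul_eq_zero {d : Q → ℝ} (hd : Continuous d)
    (h : ∀ ν : Q → ℝ, Continuous ν → HasCompactSupport ν → ∫ u, ν u * d u ∂lam = 0) (x : Q) :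
    d x = 0 := by
  by_contra hx
  obtain ⟨ψ, hψ1, -, hψc, hψ01⟩ := exists_continuous_one_zero_of_isCompact
    (isCompact_singleton (x := x)) isClosed_empty (Set.disjoint_empty _)
  have hpos := Continuous.integral_pos_of_hasCompactSupport_nonneg_nonzero (μ := lam)
    (f := fun u => ψ u * d u * d u) (x := x) (by fun_prop) (hψc.mul_right.mul_right)
    (fun u => by
      have := mul_nonneg (hψ01 u).1 (mul_self_nonneg (d u))
      simpa [mul_assoc] using this)
    (by simpa [hψ1 (Set.mem_singleton x)] using hx)
  exact hpos.ne' (h (fun u => ψ u * d u) (by fun_prop) hψc.mul_right)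

variable [SecondCountableTopology Q]

/-- For merely bounded continuous `F`, translation need not be norm continuous, so `M` cannot simply
be moved inside the integral against `σ`. A second smearing by a test function `ν` makes the
integrals Bochner integrals. Fubini then shows that the smeared mean depends on `σ` only through `∫
σ`, which translation preserves, and varying `ν` removes the smearing. -/
theorem mean_smear_translate (M : (Q →ᵇ ℝ) →L[ℝ] ℝ)
    (hM : ∀ (g : Q) (F : Q →ᵇ ℝ), M (translateBdd g F) = M F)
    {σ : Q → ℝ} (hσ : Continuous σ) (hσc : HasCompactSupport σ) (F : Q →ᵇ ℝ) (g : Q) :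
    M (smear lam (ContinuousMap.id Q) (hσ.comp (continuous_const_mul g))
      (HasCompactSupport.comp_mul_left hσc g) F) = M (smear lam (ContinuousMap.id Q) hσ hσc F) := by
  let inv' : C(Q, Q) := ⟨fun s => s⁻¹, continuous_inv⟩
  have key : ∀ {τ : Q → ℝ} (hτ : Continuous τ) (hτc : HasCompactSupport τ) (ν : Q → ℝ)
      (hν : Continuous ν) (hνc : HasCompactSupport ν),
      ∫ u, ν u * M (smear lam (ContinuousMap.id Q) (hτ.comp (continuous_const_mul u))
        (HasCompactSupport.comp_mul_left hτc u) F) ∂lam =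
      (∫ s, τ s ∂lam) * M (smear lam inv' hν hνc F) := by
    intro τ hτ hτc ν hν hνc
    let A : Q → Q →ᵇ ℝ := fun u => smear lam (ContinuousMap.id Q)
      (hτ.comp (continuous_const_mul u)) (HasCompactSupport.comp_mul_left hτc u) F
    let E : Q → Q →ᵇ ℝ := fun s => smear lam inv'
      (hν.comp (continuous_const_mul s)) (HasCompactSupport.comp_mul_left hνc s) F
    have hA : Continuous A := continuous_smear_translate _ hτ hτc F
    have hE : Continuous E := continuous_smear_translate _ hν hνc F
    have hAi : Integrable (fun u => ν u • A u) lam :=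
      (hν.smul hA).integrable_of_hasCompactSupport hνc.smul_right
    have hEi : Integrable (fun s => τ s • E s) lam :=
      (hτ.smul hE).integrable_of_hasCompactSupport hτc.smul_right
    have hAv : ∀ u t, A u t = ∫ s, τ s * F (u⁻¹ * s * t) ∂lam := fun u t => by
      have := integral_mul_left_eq_self (μ := lam) (fun s => τ s * F (u⁻¹ * s * t)) u
      simpa [A, smear_apply] using this
    have hEv : ∀ s t, E s t = ∫ u, ν u * F (u⁻¹ * s * t) ∂lam := fun s t => by
      have := integral_mul_left_eq_self (μ := lam) (fun u => ν u * F (u⁻¹ * s * t)) s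
      simpa [E, smear_apply, inv'] using this
    have hEtr : ∀ s, M (E s) = M (smear lam inv' hν hνc F) := fun s => by
      rw [← hM s (smear lam inv' hν hνc F)]
      congr 1
      ext t
      rw [hEv]
      simp [translateBdd, smear_apply, inv', mul_assoc]
    have hswap : ∫ u, ν u • A u ∂lam = ∫ s, τ s • E s ∂lam := by
      ext t
      have e1 := (BoundedContinuousFunction.evalCLM ℝ t).integral_comp_comm hAi
      have e2 := (BoundedContinuousFunction.evalCLM ℝ t).integral_comp_comm hEi
      simp only [BoundedContinuousFunction.evalCLM_apply, BoundedContinuousFunction.smul_apply,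
        smul_eq_mul] at e1 e2
      rw [← e1, ← e2]
      simp_rw [hAv, hEv, ← integral_const_mul]
      rw [integral_integral_swap]
      · congr 1
        funext s
        congr 1
        funext u
        ring
      · refine Continuous.integrable_of_hasCompactSupport ?_ ?_
        · simp only [Function.uncurry_def]
          fun_prop
        · refine HasCompactSupport.intro (hνc.isCompact.prod hτc.isCompact) ?_
          rintro ⟨u, s⟩ hus
          simp only [Function.uncurry_def]
          by_contra hne
          exact hus ⟨subset_tsupport _ (left_ne_zero_of_mul hne),
            subset_tsupport _ (left_ne_zero_of_mul (right_ne_zero_of_mul hne))⟩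
    calc ∫ u, ν u * M (A u) ∂lam = ∫ u, M (ν u • A u) ∂lam := by simp
      _ = M (∫ u, ν u • A u ∂lam) := M.integral_comp_comm hAi
      _ = M (∫ s, τ s • E s ∂lam) := by rw [hswap]
      _ = ∫ s, M (τ s • E s) ∂lam := (M.integral_comp_comm hEi).symm
      _ = ∫ s, τ s * M (smear lam inv' hν hνc F) ∂lam := by simp [hEtr]
      _ = _ := integral_mul_const _ _
  let σ' : Q → ℝ := fun s => σ (g * s)
  have hσ' : Continuous σ' := hσ.comp (continuous_const_mul g)
  have hσ'c : HasCompactSupport σ' := HasCompactSupport.comp_mul_left hσc g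
  have hD : ∀ {τ : Q → ℝ} (hτ : Continuous τ) (hτc : HasCompactSupport τ),
      Continuous fun u => M (smear lam (ContinuousMap.id Q) (hτ.comp (continuous_const_mul u))
        (HasCompactSupport.comp_mul_left hτc u) F) := fun hτ hτc =>
    M.continuous.comp (continuous_smear_translate _ hτ hτc F)
  have h0 := eq_zero_of_forall_integral_mul_eq_zero (lam := lam) ((hD hσ' hσ'c).sub (hD hσ hσc))
    (fun ν hν hνc => by
      simp only [Pi.sub_apply, mul_sub]
      rw [integral_sub, key hσ' hσ'c ν hν hνc, key hσ hσc ν hν hνc,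
        integral_mul_left_eq_self (μ := lam) σ g, sub_self]
      · exact (hν.mul (hD hσ' hσ'c)).integrable_of_hasCompactSupport hνc.mul_right
      · exact (hν.mul (hD hσ hσc)).integrable_of_hasCompactSupport hνc.mul_right) 1
  simp only [Pi.sub_apply, sub_eq_zero] at h0
  have h1 : ∀ {τ : Q → ℝ} (hτ : Continuous τ) (hτc : HasCompactSupport τ),
      smear lam (ContinuousMap.id Q) (hτ.comp (continuous_const_mul 1))
        (HasCompactSupport.comp_mul_left hτc 1) F = smear lam (ContinuousMap.id Q) hτ hτc F := by
    intro τ hτ hτc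
    ext t
    simp [smear_apply]
  rwa [h1, h1] at h0

end Mean

/-! ### Almost invariant vectors in `L¹` -/

section Reiter

variable {Q : Type*} [Group Q] [TopologicalSpace Q] [IsTopologicalGroup Q]
  [LocallyCompactSpace Q] [SecondCountableTopology Q] [MeasurableSpace Q] [BorelSpace Q]
  {lam : Measure Q} [lam.IsHaarMeasure] [lam.InnerRegularCompactLTTop]

/-- Left translation on `L¹`. -/
noncomputable def translateLp (lam : Measure Q) [lam.IsHaarMeasure] (g : Q) :
    Lp ℝ 1 lam →L[ℝ] Lp ℝ 1 lam :=
  LinearMap.mkContinuous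
    { toFun := fun f => DomMulAct.mk g⁻¹ • f
      map_add' := fun f f' => smul_add _ f f'
      map_smul' := fun c f => (smul_comm c (DomMulAct.mk g⁻¹) f).symm } 1
    fun f => by simp [DomMulAct.norm_smul_Lp]

theorem translateLp_apply (g : Q) (f : Lp ℝ 1 lam) :
    translateLp lam g f = DomMulAct.mk g⁻¹ • f := rfl

theorem translateLp_coeFn (g : Q) (f : Lp ℝ 1 lam) :
    translateLp lam g f =ᵐ[lam] fun x => f (g⁻¹ * x) := by
  rw [translateLp_apply]
  exact DomMulAct.smul_Lp_ae_eq _ f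

theorem norm_translateLp (g : Q) (f : Lp ℝ 1 lam) : ‖translateLp lam g f‖ = ‖f‖ := by
  rw [translateLp_apply, DomMulAct.norm_smul_Lp]

theorem translateLp_mul (g h : Q) (f : Lp ℝ 1 lam) :
    translateLp lam (g * h) f = translateLp lam g (translateLp lam h f) := by
  simp only [translateLp_apply]
  rw [smul_smul, ← DomMulAct.mk_mul, mul_inv_rev]

theorem continuous_translateLp (f : Lp ℝ 1 lam) : Continuous fun g => translateLp lam g f := by
  have : Fact ((1 : ℝ≥0∞) ≠ ∞) := ⟨ENNReal.one_ne_top⟩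
  simp only [translateLp_apply]
  exact (DomMulAct.continuous_mk.comp continuous_inv).smul continuous_const

theorem integral_translateLp (g : Q) (f : Lp ℝ 1 lam) :
    L1.integralCLM (translateLp lam g f) = L1.integralCLM f := by
  rw [← L1.integral_eq, ← L1.integral_eq, L1.integral_eq_integral, L1.integral_eq_integral,
    integral_congr_ae (translateLp_coeFn g f), integral_mul_left_eq_self (fun x => f x)]

/-- The convolution `σ * v` of a compactly supported function with an element of `L¹`. -/
noncomputable def convLp (lam : Measure Q) [lam.IsHaarMeasure] (σ : Q → ℝ) (v : Lp ℝ 1 lam) :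
    Lp ℝ 1 lam := ∫ s, σ s • translateLp lam s v ∂lam

theorem integrable_convLp {σ : Q → ℝ} (hσ : Continuous σ) (hσc : HasCompactSupport σ)
    (v : Lp ℝ 1 lam) : Integrable (fun s => σ s • translateLp lam s v) lam :=
  (hσ.smul (continuous_translateLp v)).integrable_of_hasCompactSupport hσc.smul_right

theorem translateLp_convLp {σ : Q → ℝ} (hσ : Continuous σ) (hσc : HasCompactSupport σ)
    (v : Lp ℝ 1 lam) (g : Q) :
    translateLp lam g (convLp lam σ v) = convLp lam (fun s => σ (g⁻¹ * s)) v := by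
  rw [convLp, ← ContinuousLinearMap.integral_comp_comm _ (integrable_convLp hσ hσc v), convLp,
    ← integral_mul_left_eq_self (μ := lam) (fun s => σ (g⁻¹ * s) • translateLp lam s v) g]
  simp only [map_smul, translateLp_mul, inv_mul_cancel_left]

theorem norm_convLp_sub_le {σ τ : Q → ℝ} (hσ : Continuous σ) (hσc : HasCompactSupport σ)
    (hτ : Continuous τ) (hτc : HasCompactSupport τ) (v : Lp ℝ 1 lam) :
    ‖convLp lam σ v - convLp lam τ v‖ ≤ (∫ s, |σ s - τ s| ∂lam) * ‖v‖ := by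
  rw [convLp, convLp, ← integral_sub (integrable_convLp hσ hσc v) (integrable_convLp hτ hτc v),
    ← integral_mul_const]
  refine norm_integral_le_of_norm_le (((hσ.sub hτ).abs.integrable_of_hasCompactSupport
    (hσc.sub hτc).abs).mul_const _) (Eventually.of_forall fun s => ?_)
  rw [← sub_smul, norm_smul, norm_translateLp, Real.norm_eq_abs]

theorem integral_convLp {σ : Q → ℝ} (hσ : Continuous σ) (hσc : HasCompactSupport σ)
    (v : Lp ℝ 1 lam) :
    L1.integralCLM (convLp lam σ v) = (∫ s, σ s ∂lam) * L1.integralCLM v := by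
  rw [convLp, ← ContinuousLinearMap.integral_comp_comm _ (integrable_convLp hσ hσc v)]
  simp only [map_smul, integral_translateLp, smul_eq_mul]
  exact integral_mul_const _ _

/-- The matrix coefficient `t ↦ Φ(t · B)` of the translation representation on `L¹`. -/
noncomputable def coefficient (Φ : Lp ℝ 1 lam →L[ℝ] ℝ) (B : Lp ℝ 1 lam) : Q →ᵇ ℝ :=
  BoundedContinuousFunction.ofNormedAddCommGroup (fun t => Φ (translateLp lam t B))
    (Φ.continuous.comp (continuous_translateLp B)) (‖Φ‖ * ‖B‖) fun t => by
      rw [← norm_translateLp t B]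
      exact Φ.le_opNorm _

theorem apply_convLp_translateLp (Φ : Lp ℝ 1 lam →L[ℝ] ℝ) (B : Lp ℝ 1 lam) {σ : Q → ℝ}
    (hσ : Continuous σ) (hσc : HasCompactSupport σ) (t : Q) :
    Φ (convLp lam σ (translateLp lam t B)) =
      smear lam (ContinuousMap.id Q) hσ hσc (coefficient Φ B) t := by
  rw [convLp, ← ContinuousLinearMap.integral_comp_comm _ (integrable_convLp hσ hσc _), smear_apply]
  simp [coefficient, translateLp_mul]

theorem exists_normalized_bump (lam : Measure Q) [lam.IsHaarMeasure] :
    ∃ σ : Q → ℝ, Continuous σ ∧ HasCompactSupport σ ∧ ∫ s, σ s ∂lam = 1 := by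
  obtain ⟨ψ, hψ1, -, hψc, hψ01⟩ := exists_continuous_one_zero_of_isCompact
    (isCompact_singleton (x := (1 : Q))) isClosed_empty (Set.disjoint_empty _)
  have hpos := ψ.continuous.integral_pos_of_hasCompactSupport_nonneg_nonzero (μ := lam) (x := 1)
    hψc (fun u => (hψ01 u).1) (by simp [hψ1 (Set.mem_singleton (1 : Q))])
  refine ⟨fun s => ψ s * (∫ s, ψ s ∂lam)⁻¹, by fun_prop, hψc.mul_right, ?_⟩
  rw [integral_mul_const, mul_inv_cancel₀ hpos.ne']

/-- Day's convexity argument: a functional separating 0 from the displacements of the convex hull of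
the `X t` would give a function of `t` bounded below by `u > 0`, yet its mean vanishes by
`mean_smear_translate`. Convolution with `σ` makes translation equicontinuous on the hull, so a
finite subset `T` controls all of `L`. -/
theorem exists_almost_invariant_L1 (hQ : IsAmenable Q) {L : Set Q} (hL : IsCompact L) {ε : ℝ}
    (hε : 0 < ε) : ∃ f : Lp ℝ 1 lam, 1 ≤ ‖f‖ ∧ ∀ g ∈ L, ‖translateLp lam g f - f‖ ≤ ε := by
  classical
  obtain ⟨M, hM1, hMpos, hM⟩ := hQ.exists_mean
  obtain ⟨σ, hσ, hσc, hσ1⟩ := exists_normalized_bump lam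
  have hBint : Integrable σ lam := hσ.integrable_of_hasCompactSupport hσc
  set B : Lp ℝ 1 lam := hBint.toL1 σ with hB
  have hB1 : L1.integralCLM B = 1 := by
    rw [← L1.integral_eq, L1.integral_eq_integral, integral_congr_ae hBint.coeFn_toL1, hσ1]
  have hσg : ∀ g : Q, Continuous fun s => σ (g * s) := fun g => hσ.comp (continuous_const_mul g)
  have hσgc : ∀ g : Q, HasCompactSupport fun s => σ (g * s) := fun g =>
    HasCompactSupport.comp_mul_left hσc g
  -- Chosen so that `δ * (‖B‖ + 1) = ε / 2`; the added 1 avoids division by zero.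
  set δ := ε / 2 / (‖B‖ + 1) with hδ
  have hδ0 : 0 < δ := by positivity
  have hnhds : ∀ g ∈ L, {g' : Q | ∫ s, |σ (g'⁻¹ * s) - σ (g⁻¹ * s)| ∂lam < δ} ∈ 𝓝 g := by
    intro g _
    have := (tendsto_integral_abs_sub_translate (lam := lam) hσ hσc g⁻¹).comp
      (continuous_inv.tendsto g)
    exact this.eventually (gt_mem_nhds hδ0)
  obtain ⟨T, -, hT⟩ := hL.elim_nhds_subcover _ hnhds
  let X : Q → Lp ℝ 1 lam := fun t => convLp lam σ (translateLp lam t B)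
  let D : Lp ℝ 1 lam →L[ℝ] (T → Lp ℝ 1 lam) := ContinuousLinearMap.pi fun g =>
    translateLp lam (g : Q) - ContinuousLinearMap.id ℝ _
  have hD : ∀ f g, D f g = translateLp lam (g : Q) f - f := fun f g => rfl
  have hcl : (0 : T → Lp ℝ 1 lam) ∈ closure (D '' convexHull ℝ (Set.range X)) := by
    by_contra hne
    have hconv : Convex ℝ (D '' convexHull ℝ (Set.range X)) :=
      (convex_convexHull ℝ _).linear_image D.toLinearMap
    obtain ⟨Φ, u, hu0, hu⟩ := geometric_hahn_banach_point_closed hconv.closure isClosed_closure hne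
    rw [map_zero] at hu0
    let Ψ : T → Lp ℝ 1 lam →L[ℝ] ℝ := fun g =>
      Φ.comp (ContinuousLinearMap.single ℝ (fun _ : T => Lp ℝ 1 lam) g)
    let S : Q →ᵇ ℝ := ∑ g : T, (smear lam (ContinuousMap.id Q) (hσg (g : Q)⁻¹) (hσgc (g : Q)⁻¹)
      (coefficient (Ψ g) B) - smear lam (ContinuousMap.id Q) hσ hσc (coefficient (Ψ g) B))
    have hS : ∀ t, S t = Φ (D (X t)) := by
      intro t
      have h1 : Φ (D (X t)) = ∑ g : T, Ψ g (D (X t) g) := by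
        conv_lhs => rw [← Finset.univ_sum_single (D (X t))]
        rw [map_sum]
        rfl
      rw [h1, BoundedContinuousFunction.sum_apply]
      refine Finset.sum_congr rfl fun g _ => ?_
      rw [hD, translateLp_convLp hσ hσc, map_sub, apply_convLp_translateLp _ _ (hσg _) (hσgc _),
        apply_convLp_translateLp _ _ hσ hσc, BoundedContinuousFunction.sub_apply]
    have hMS : M S = 0 := by
      rw [map_sum]
      refine Finset.sum_eq_zero fun g _ => ?_
      rw [map_sub, mean_smear_translate M hM hσ hσc, sub_self]
    have h2 := hMpos (S - u • BoundedContinuousFunction.const Q 1) fun t => by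
      have := hu (D (X t)) (subset_closure ⟨_, subset_convexHull ℝ _ ⟨t, rfl⟩, rfl⟩)
      rw [← hS] at this
      simpa using this.le
    rw [map_sub, map_smul, hM1, hMS, smul_eq_mul] at h2
    linarith
  obtain ⟨_, ⟨f, hf, rfl⟩, hfd⟩ := Metric.mem_closure_iff.1 hcl (ε / 2) (half_pos hε)
  rw [dist_zero_left] at hfd
  refine ⟨f, ?_, fun g hg => ?_⟩
  -- The integral is 1 throughout the hull, which bounds the norm below without any positivity.
  · have h1 : convexHull ℝ (Set.range X) ⊆ {f | L1.integralCLM f = (1 : ℝ)} := by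
      refine convexHull_min ?_
        (convex_hyperplane (L1.integralCLM (α := Q) (E := ℝ) (μ := lam)).toLinearMap.isLinear 1)
      rintro _ ⟨t, rfl⟩
      change L1.integralCLM (convLp lam σ (translateLp lam t B)) = (1 : ℝ)
      rw [integral_convLp hσ hσc, integral_translateLp, hσ1, hB1, mul_one]
    have h2 := L1.norm_integral_le f
    rw [L1.integral_eq, h1 hf, norm_one] at h2
    exact h2
  · obtain ⟨g₀, hg₀, hgg₀⟩ := Set.mem_iUnion₂.1 (hT hg)
    have h1 : convexHull ℝ (Set.range X) ⊆
        (translateLp lam g - translateLp lam g₀).toLinearMap ⁻¹' Metric.closedBall 0 (ε / 2) := by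
      refine convexHull_min ?_ ((convex_closedBall 0 (ε / 2)).linear_preimage _)
      rintro _ ⟨t, rfl⟩
      change convLp lam σ (translateLp lam t B) ∈ _
      rw [Set.mem_preimage, mem_closedBall_zero_iff]
      change ‖translateLp lam g (convLp lam σ _) - translateLp lam g₀ (convLp lam σ _)‖ ≤ _
      rw [translateLp_convLp hσ hσc, translateLp_convLp hσ hσc]
      refine (norm_convLp_sub_le (hσg _) (hσgc _) (hσg _) (hσgc _) _).trans ?_
      rw [norm_translateLp]
      calc _ ≤ δ * (‖B‖ + 1) := by
            refine mul_le_mul (le_of_lt hgg₀) (by linarith) (norm_nonneg _) hδ0.le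
        _ = ε / 2 := by rw [hδ]; field_simp
    have h2 := h1 hf
    rw [Set.mem_preimage, mem_closedBall_zero_iff] at h2
    change ‖translateLp lam g f - translateLp lam g₀ f‖ ≤ _ at h2
    have h3 := (norm_le_pi_norm (D f) ⟨g₀, hg₀⟩).trans hfd.le
    rw [hD] at h3
    have h4 := norm_add_le (translateLp lam g f - translateLp lam g₀ f) (translateLp lam g₀ f - f)
    rw [sub_add_sub_cancel] at h4
    simp only at h3
    linarith

end Reiter

/-! ### Extensions with amenable quotient -/

section Amenable

/-- Almost invariance passes from `L¹` to `L²` by `(√a - √b)² ≤ |a - b|`, after `f` is replaced by a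
continuous compactly supported `k` and then by the density `|k| / N`. -/
theorem exists_almost_invariant_sqrt {Q : Type*} [Group Q] [TopologicalSpace Q]
    [IsTopologicalGroup Q] [LocallyCompactSpace Q] [T2Space Q] [SecondCountableTopology Q]
    [MeasurableSpace Q] [BorelSpace Q] {lam : Measure Q} [lam.IsHaarMeasure] [lam.Regular]
    (hQ : IsAmenable Q) {L : Set Q} (hL : IsCompact L) {ε : ℝ} (hε : 0 < ε) :
    ∃ h : Q → ℝ, Continuous h ∧ HasCompactSupport h ∧ (∀ z, 0 ≤ h z) ∧ ∫ z, h z ^ 2 ∂lam ≤ 1 ∧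
      ∀ g ∈ L, 1 - ε ≤ ∫ z, h z * h (g * z) ∂lam := by
  -- This guarantees `N ≥ 2/3`, so dividing by `N` at most doubles the error `ε`.
  wlog hε1 : ε ≤ 1 generalizing ε
  · obtain ⟨h, h1, h2, h3, h4, h5⟩ := this one_pos le_rfl
    exact ⟨h, h1, h2, h3, h4, fun g hg => by linarith [h5 g hg, not_le.1 hε1]⟩
  obtain ⟨f, hf1, hfL⟩ := exists_almost_invariant_L1 (lam := lam) hQ hL.inv (ε := ε / 3)
    (by positivity)
  obtain ⟨k, hkc, hkf, hkcont, hkm⟩ := (Lp.memLp f).exists_hasCompactSupport_eLpNorm_sub_le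
    ENNReal.one_ne_top (ε := ENNReal.ofReal (ε / 3)) (by simpa using hε)
  have hki : Integrable k lam := memLp_one_iff_integrable.1 hkm
  set k' : Lp ℝ 1 lam := hki.toL1 k with hk'
  have hk'v : k' =ᵐ[lam] k := hki.coeFn_toL1
  have hfk : ‖f - k'‖ ≤ ε / 3 := by
    rw [Lp.norm_def]
    refine ENNReal.toReal_le_of_le_ofReal (by positivity) (le_trans (le_of_eq ?_) hkf)
    refine eLpNorm_congr_ae ?_
    filter_upwards [Lp.coeFn_sub f k', hk'v] with x h1 h2
    rw [h1, Pi.sub_apply, Pi.sub_apply, h2]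
  set N := ∫ z, |k z| ∂lam with hN
  have hk'N : ‖k'‖ = N := by
    rw [L1.norm_eq_integral_norm, hN]
    refine integral_congr_ae ?_
    filter_upwards [hk'v] with z hz
    rw [hz, Real.norm_eq_abs]
  have hNpos : 1 - ε / 3 ≤ N := by
    have := norm_sub_norm_le f k'
    linarith
  have hN0 : 0 < N := by linarith
  have hinv : ∀ g ∈ L, ∫ z, |(|k z| - |k (g * z)|)| ∂lam ≤ ε := by
    intro g hg
    have h1 : ‖translateLp lam g⁻¹ k' - k'‖ ≤ ε := by
      have e : translateLp lam g⁻¹ k' - k' = -translateLp lam g⁻¹ (f - k') +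
          (translateLp lam g⁻¹ f - f) + (f - k') := by
        rw [map_sub]; abel
      rw [e]
      refine (norm_add₃_le).trans ?_
      rw [norm_neg, norm_translateLp]
      have := hfL g⁻¹ (Set.inv_mem_inv.2 hg)
      linarith
    refine le_trans ?_ h1
    rw [L1.norm_eq_integral_norm]
    have h2 : (fun z => ‖(translateLp lam g⁻¹ k' - k') z‖) =ᵐ[lam] fun z => |k (g * z) - k z| := by
      have h3 : ∀ᵐ z ∂lam, k' (g * z) = k (g * z) :=
        (measurePreserving_mul_left lam g).quasiMeasurePreserving.ae hk'v
      filter_upwards [Lp.coeFn_sub (translateLp lam g⁻¹ k') k', translateLp_coeFn g⁻¹ k', hk'v, h3]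
        with z e1 e2 e3 e4
      rw [e1, Pi.sub_apply, e2, inv_inv, e3, e4, Real.norm_eq_abs]
    rw [integral_congr_ae h2]
    have hkg : Integrable (fun z => k (g * z)) lam := hki.comp_mul_left g
    refine integral_mono (hki.abs.sub hkg.abs).abs (hkg.sub hki).abs fun z => ?_
    rw [abs_sub_comm (k (g * z))]
    exact abs_abs_sub_abs_le _ _
  let h : Q → ℝ := fun z => √(|k z| / N)
  have hsq : ∀ z, h z ^ 2 = |k z| / N := fun z => Real.sq_sqrt (by positivity)
  have hcont : Continuous h := (hkcont.abs.div_const N).sqrt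
  have hcs : HasCompactSupport h := by
    refine HasCompactSupport.intro hkc fun z hz => ?_
    simp [h, image_eq_zero_of_notMem_tsupport hz]
  have hint : ∫ z, h z ^ 2 ∂lam = 1 := by
    simp_rw [hsq]
    rw [integral_div, ← hN, div_self hN0.ne']
  refine ⟨h, hcont, hcs, fun z => Real.sqrt_nonneg _, hint.le, fun g hg => ?_⟩
  have hi : Integrable (fun z => h z ^ 2) lam := by
    simp_rw [hsq]
    exact hki.abs.div_const N
  have hig : Integrable (fun z => h (g * z) ^ 2) lam := hi.comp_mul_left g
  have hintg : ∫ z, h (g * z) ^ 2 ∂lam = 1 := by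
    rw [integral_mul_left_eq_self (fun z => h z ^ 2) g, hint]
  have hd : Integrable (fun z => |(|k z| - |k (g * z)|)| / N) lam :=
    ((hki.abs.sub (hki.comp_mul_left g).abs).abs).div_const N
  have hpt : ∀ z, (h z ^ 2 + h (g * z) ^ 2 - |(|k z| - |k (g * z)|)| / N) / 2 ≤
      h z * h (g * z) := by
    intro z
    have e : |(|k z| - |k (g * z)|)| / N = |h z ^ 2 - h (g * z) ^ 2| := by
      rw [hsq, hsq, ← sub_div, abs_div, abs_of_pos hN0]
    rw [e]
    have h1 : (h z - h (g * z)) ^ 2 ≤ |h z ^ 2 - h (g * z) ^ 2| := by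
      have h2 : h z ^ 2 - h (g * z) ^ 2 = (h z - h (g * z)) * (h z + h (g * z)) := by ring
      have h3 : 0 ≤ h z := Real.sqrt_nonneg _
      have h4 : 0 ≤ h (g * z) := Real.sqrt_nonneg _
      rw [h2, abs_mul, ← sq_abs, sq]
      refine mul_le_mul_of_nonneg_left ?_ (abs_nonneg _)
      rw [abs_of_nonneg (add_nonneg h3 h4), abs_le]
      constructor <;> linarith
    nlinarith
  have hle : ∫ z, |(|k z| - |k (g * z)|)| / N ∂lam ≤ 2 * ε := by
    rw [integral_div, div_le_iff₀ hN0]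
    have := hinv g hg
    nlinarith
  calc 1 - ε ≤ ∫ z, (h z ^ 2 + h (g * z) ^ 2 - |(|k z| - |k (g * z)|)| / N) / 2 ∂lam := by
        have e : ∫ z, (h z ^ 2 + h (g * z) ^ 2 - |(|k z| - |k (g * z)|)| / N) ∂lam =
            ∫ z, (h z ^ 2 + h (g * z) ^ 2) ∂lam - ∫ z, |(|k z| - |k (g * z)|)| / N ∂lam :=
          integral_sub (hi.add hig) hd
        rw [integral_div, e, integral_add hi hig, hint, hintg]
        linarith
    _ ≤ ∫ z, h z * h (g * z) ∂lam := by
        refine integral_mono (((hi.add hig).sub hd).div_const 2) ?_ hpt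
        exact Continuous.integrable_of_hasCompactSupport
          (hcont.mul (hcont.comp (continuous_const_mul g))) hcs.mul_right

theorem NetBound.of_amenable_quotient {G : Type*} [Group G] [TopologicalSpace G]
    [IsTopologicalGroup G] [T2Space G] [LocallyCompactSpace G] [SecondCountableTopology G]
    (N : Subgroup G) [N.Normal] (hN : IsClosed (N : Set G)) (hQ : IsAmenable (G ⧸ N)) {C : ℝ}
    (h : NetBound N C) : NetBound G C := by
  let _ : MeasurableSpace (G ⧸ N) := borel _
  have : BorelSpace (G ⧸ N) := ⟨rfl⟩
  have : T2Space (G ⧸ N) := t2Space_quotient hN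
  let lam : Measure (G ⧸ N) := Measure.haar
  -- `G` acts on the quotient group through left multiplication by images, so Haar measure is
  -- invariant.
  have : SMulInvariantMeasure G (G ⧸ N) lam := ⟨fun g s _ => by
    have h1 : (fun z : G ⧸ N => g • z) = fun z => (g : G ⧸ N) * z := by
      funext z
      obtain ⟨x, rfl⟩ := QuotientGroup.mk_surjective z
      rfl
    rw [h1]
    exact measure_preimage_mul lam _ s⟩
  refine NetBound.of_almost_invariant hN lam (fun L hL ε hε => ?_) h
  obtain ⟨h, h1, h2, h3, h4, h5⟩ := exists_almost_invariant_sqrt (lam := lam) hQ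
    (hL.image (QuotientGroup.continuous_mk (N := N))) hε
  refine ⟨h, h1, h2, h3, h4, fun g hg => (h5 g (Set.mem_image_of_mem _ hg)).trans_eq ?_⟩
  congr 1

/-- A left-equivariant retraction of a group onto a subgroup. -/
theorem exists_equivariant_retraction {Q : Type*} [Group Q] (S : Subgroup Q) :
    ∃ r : Q → S, ∀ (s : S) (q : Q), r (s * q) = s * r q := by
  have hex : ∀ q : Q, ∃ s : S, (Quotient.mk (QuotientGroup.rightRel S) q).out = s * q := fun q => by
    have := Quotient.exact (Quotient.out_eq (Quotient.mk (QuotientGroup.rightRel S) q))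
    change QuotientGroup.rightRel S _ _ at this
    rw [QuotientGroup.rightRel_apply] at this
    exact ⟨⟨_, S.inv_mem this⟩, by simp⟩
  choose t ht using hex
  refine ⟨fun q => (t q)⁻¹, fun s q => ?_⟩
  have h1 : Quotient.mk (QuotientGroup.rightRel S) (s * q) = Quotient.mk _ q := by
    refine Quotient.sound ?_
    change QuotientGroup.rightRel S _ _
    rw [QuotientGroup.rightRel_apply]
    simp
  have h2 := ht (s * q)
  rw [h1, ht q, ← mul_assoc] at h2
  have h3 : t q = t (s * q) * s := Subtype.ext (mul_right_cancel h2)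
  change (t (s * q))⁻¹ = s * (t q)⁻¹
  rw [h3]
  group

/-- An equivariant retraction pulls functions on `R` back to `Q`; it is continuous because `Q` is
discrete, and translations are intertwined. -/
theorem IsAmenable.of_injective {Q : Type*} [Group Q] [TopologicalSpace Q] [IsTopologicalGroup Q]
    [DiscreteTopology Q] {R : Type*} [Group R] [TopologicalSpace R] [IsTopologicalGroup R]
    (hQ : IsAmenable Q) (φ : R →* Q) (hφ : Function.Injective φ) : IsAmenable R := by
  obtain ⟨r, hr⟩ := exists_equivariant_retraction φ.range
  let e : R ≃* φ.range := MonoidHom.ofInjective hφ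
  let ρ : C(Q, R) := ⟨fun q => e.symm (r q), continuous_of_discreteTopology⟩
  have hρ : ∀ g q, ρ (φ g * q) = g * ρ q := fun g q => by
    have := hr (e g) q
    change e.symm (r (φ g * q)) = g * e.symm (r q)
    rw [MulEquiv.symm_apply_eq, map_mul, MulEquiv.apply_symm_apply, ← this]
    rfl
  obtain ⟨m, hpos, hone, hinv⟩ := hQ
  refine ⟨{ toFun := fun F => m (F.compContinuous ρ)
            map_add' := fun F F' => by rw [← map_add]; rfl
            map_smul' := fun c F => by rw [RingHom.id_apply, ← map_smul]; rfl }, ?_, ?_, ?_⟩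
  · exact fun F hF => hpos _ fun q => hF _
  · exact hone
  · intro g F
    change m _ = m _
    rw [← hinv (φ g) (F.compContinuous ρ)]
    congr 1
    ext q
    change F (g * ρ q) = F (ρ (φ g * q))
    rw [hρ]

/-- A compact set is finite and generates a countable, hence second countable, subgroup. Its
quotient embeds in `G ⧸ N` and so is amenable; the function found there extends by zero. -/
theorem NetBound.of_amenable_quotient_discrete {G : Type*} [Group G] [TopologicalSpace G]
    [IsTopologicalGroup G] [DiscreteTopology G] (N : Subgroup G) [N.Normal]
    (hQ : IsAmenable (G ⧸ N)) {C : ℝ} (h : NetBound N C) : NetBound G C := by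
  intro L hL ε hε
  have hLf : L.Finite := isCompact_iff_finite.1 hL
  let G₀ : Subgroup G := Subgroup.closure L
  have : Countable L := hLf.countable
  have hG₀ : Countable G₀ := by
    have h1 : (FreeGroup.lift ((↑) : L → G)).range = G₀ := by
      rw [FreeGroup.range_lift_eq_closure, Subtype.range_coe]
    rw [← h1]
    exact (Set.countable_range (FreeGroup.lift ((↑) : L → G))).to_subtype
  let N₀ : Subgroup G₀ := N.subgroupOf G₀
  have : DiscreteTopology (G ⧸ N) := QuotientGroup.discreteTopology (isOpen_discrete _)
  have hinj : Function.Injective (QuotientGroup.map N₀ N G₀.subtype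
      (show N₀ ≤ N.comap G₀.subtype from le_rfl)) := by
    rw [injective_iff_map_eq_one]
    intro z hz
    obtain ⟨x, rfl⟩ := QuotientGroup.mk_surjective z
    rw [QuotientGroup.map_mk, QuotientGroup.eq_one_iff] at hz
    exact (QuotientGroup.eq_one_iff x).2 hz
  have hQ₀ : IsAmenable (G₀ ⧸ N₀) := hQ.of_injective _ hinj
  let ψ : N₀ →* N :=
    { toFun := fun x => ⟨((x : G₀) : G), x.2⟩
      map_one' := rfl
      map_mul' := fun _ _ => rfl }
  have hψ : IsClosedEmbedding ψ := by
    refine IsClosedEmbedding.of_continuous_injective_isClosedMap continuous_of_discreteTopology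
      (fun x y hxy => ?_) fun s _ => isClosed_discrete _
    have := congrArg Subtype.val hxy
    exact Subtype.ext (Subtype.ext this)
  have h₀ : NetBound G₀ C :=
    (h.of_isClosedEmbedding ψ hψ).of_amenable_quotient N₀ (isClosed_discrete _) hQ₀
  have hemb : IsOpenEmbedding G₀.subtype := (isOpen_discrete (G₀ : Set G)).isOpenEmbedding_subtypeVal
  obtain ⟨f, f1, f2, f3, f4⟩ := h₀ (((↑) : G₀ → G) ⁻¹' L)
    (hemb.isInducing.isCompact_preimage' hL fun x hx => ⟨⟨x, Subgroup.subset_closure hx⟩, rfl⟩) ε hε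
  obtain ⟨g, g1, g2, g3, g4⟩ := exists_extension_of_isOpenEmbedding _ hemb f1 f2 f3
  refine ⟨g, g1, g2, g3, fun x hx => ?_⟩
  have h5 : G₀.subtype ⟨x, Subgroup.subset_closure hx⟩ = x := rfl
  rw [← h5, g4]
  exact f4 _ hx

end Amenable

end WeakHaagerup

/-! ### The permanence theorem -/

theorem theoremA (G : Type u) [Group G] [TopologicalSpace G] [IsTopologicalGroup G]
    [LocallyCompactSpace G] [T2Space G] :
    -- closed subgroups
    (∀ H : Subgroup G, IsClosed (H : Set G) →
      (WeakHaagerup.HasWeakHaagerup G → WeakHaagerup.HasWeakHaagerup H) ∧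
      WeakHaagerup.weakHaagerupConst H ≤ WeakHaagerup.weakHaagerupConst G) ∧
    -- quotients by compact normal subgroups
    (∀ (K : Subgroup G) [K.Normal], IsCompact (K : Set G) →
      (WeakHaagerup.HasWeakHaagerup G ↔ WeakHaagerup.HasWeakHaagerup (G ⧸ K)) ∧
      WeakHaagerup.weakHaagerupConst G = WeakHaagerup.weakHaagerupConst (G ⧸ K)) ∧
    -- finite direct products
    ((∀ (n : ℕ) (P : Fin n → Type v) [∀ i, Group (P i)] [∀ i, TopologicalSpace (P i)]
        [∀ i, IsTopologicalGroup (P i)] [∀ i, LocallyCompactSpace (P i)] [∀ i, T2Space (P i)],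
        (∀ i, WeakHaagerup.HasWeakHaagerup (P i)) → WeakHaagerup.HasWeakHaagerup (∀ i, P i)) ∧
      ∀ (G' : Type v) [Group G'] [TopologicalSpace G'] [IsTopologicalGroup G']
        [LocallyCompactSpace G'] [T2Space G'],
        WeakHaagerup.weakHaagerupConst (G × G') ≤
          WeakHaagerup.weakHaagerupConst G * WeakHaagerup.weakHaagerupConst G') ∧
    -- directed unions of open subgroups
    (∀ (I : Type w) [Preorder I] [IsDirected I (· ≤ ·)] [Nonempty I] (U : I → Subgroup G),
      Monotone U → (∀ i, IsOpen (U i : Set G)) →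
      ∀ V : Subgroup G, (V : Set G) = ⋃ i, (U i : Set G) →
        Tendsto (fun i => WeakHaagerup.weakHaagerupConst (U i)) atTop
          (𝓝 (WeakHaagerup.weakHaagerupConst V))) ∧
    -- extensions with amenable quotient
    (∀ (N : Subgroup G) [N.Normal], IsClosed (N : Set G) →
      SecondCountableTopology G ∨ DiscreteTopology G → WeakHaagerup.IsAmenable (G ⧸ N) →
      (WeakHaagerup.HasWeakHaagerup G ↔ WeakHaagerup.HasWeakHaagerup N) ∧
      WeakHaagerup.weakHaagerupConst G = WeakHaagerup.weakHaagerupConst N) ∧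
    -- lattices
    (∀ Γ : Subgroup G, SecondCountableTopology G → WeakHaagerup.IsLattice Γ →
      (WeakHaagerup.HasWeakHaagerup G ↔ WeakHaagerup.HasWeakHaagerup Γ) ∧
      WeakHaagerup.weakHaagerupConst Γ = WeakHaagerup.weakHaagerupConst G) := by
  refine ⟨fun H hH => WeakHaagerup.weakHaagerupConst_mono fun C _ h =>
      WeakHaagerup.netBound_closed_subgroup h H hH,
    fun K _ hK => WeakHaagerup.weakHaagerupConst_eq fun C _ =>
      ⟨fun h => h.compact_quotient K hK, fun h => h.of_compact_quotient K hK⟩,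
    ⟨fun n P _ _ _ _ _ h => WeakHaagerup.hasWeakHaagerup_pi n P h,
      fun G' _ _ _ _ _ => WeakHaagerup.weakHaagerupConst_prod_le G G'⟩,
    fun I _ _ _ U hU hUo V hV => WeakHaagerup.tendsto_weakHaagerupConst_iUnion U hU hUo V hV,
    fun N _ hN hG hQ => WeakHaagerup.weakHaagerupConst_eq fun C _ =>
      ⟨fun h => WeakHaagerup.netBound_closed_subgroup h N hN, fun h => ?_⟩,
    fun Γ hG hΓ => ?_⟩
  · rcases hG with hG | hG
    · exact h.of_amenable_quotient N hN hQ
    · exact h.of_amenable_quotient_discrete N hQ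
  · have := hΓ.1
    have h := WeakHaagerup.weakHaagerupConst_eq (G := G) (H := Γ) fun C _ =>
      ⟨fun h => WeakHaagerup.netBound_closed_subgroup h Γ Subgroup.isClosed_of_discrete,
        fun h => h.of_lattice hΓ⟩
    exact ⟨h.1, h.2.symm⟩
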